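/- A graph $E=(E^0,E^1,r,s)$ consists of a countable set $E^0$ of vertices, a countable set $E^1$ of edges, and range and source maps $r,s:E^1\to E^0$. A vertex $v$ is regular if $0<|s^{-1}(v)|<\infty$. For a field $K$, the Leavitt path algebra $L_K(E)$ is the (not necessarily unital) associative $K$-algebra generated by pairwise orthogonal idempotents $v\in E^0$ and elements $e,e^*$ ($e\in E^1$), subject to $s(e)e=e\,r(e)=e$, $r(e)e^*=e^*s(e)=e^*$, $e^*f=\delta_{e,f}\,r(e)$, and $v=\sum_{s(e)=v}ee^*$ for every regular $v$; for $K=\mathbb{C}$ it is a $*$-algebra through the conjugate-linear involution that fixes the vertices and exchanges $e$ and $e^*$. The graph $C^*$-algebra $C^*(E)$ is the universal $C^*$-algebra generated by mutually orthogonal projections $p_v$ ($v\in E^0$) and partial isometries $s_e$ ($e\in E^1$) with mutually orthogonal ranges such that $s_e^*s_e=p_{r(e)}$, $s_es_e^*\le p_{s(e)}$, and $p_v=\sum_{s(e)=v}s_es_e^*$ for every regular $v$. The stabilization $SE$ is the graph obtained from $E$ by attaching to every vertex $v\in E^0$ an infinite head $$\cdots\xrightarrow{e^v_4}v_3\xrightarrow{e^v_3}v_2\xrightarrow{e^v_2}v_1\xrightarrow{e^v_1}v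 .$$ For a ring $R$, ${\rm M}_\infty(R)$ is the ring of finitely supported $\mathbb{N}\times\mathbb{N}$ matrices over $R$, with the entrywise scalar multiplication if $R$ is an algebra and with the conjugate transpose as involution if $R$ is a $*$-algebra. Proposition. If $E$ is a graph, then (1) $L_{\mathbb{C}}(SE)\cong{\rm M}_\infty(L_{\mathbb{C}}(E))$ as $*$-algebras; (2) $L_K(SE)\cong{\rm M}_\infty(L_K(E))$ as $K$-algebras for every field $K$; (3) $C^*(SE)\cong C^*(E)\otimes\mathcal{K}$ as $*$-algebras, where $\mathcal{K}=\mathcal{K}(H)$ is the $C^*$-algebra of compact operators on a separable infinite-dimensional Hilbert space $H$. Here $C^*(E)\otimes\mathcal{K}$ may be taken to be the maximal $C^*$-tensor product, or the completion of the algebraic tensor product $C^*(E)\odot\mathcal{K}$ in any $C^*$-norm $\gamma$ (with $\gamma(a\otimes k)\le\|a\|\,\|k\|$, as is automatic). -/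

import Mathlib

/-! ### C*-seminorms on complex *-algebras and their completions -/

/-- A C*-seminorm on a (not necessarily unital) complex `*`-algebra. -/
structure CStarSeminorm (B : Type*) [NonUnitalRing B] [Module ℂ B] [StarRing B] extends
    Seminorm ℂ B where
  mul_le' : ∀ x y, toFun (x * y) ≤ toFun x * toFun y
  star_mul_self' : ∀ x, toFun (star x * x) = toFun x * toFun x

namespace CStarSeminorm

section Basic

variable {B : Type*} [NonUnitalRing B] [Module ℂ B] [StarRing B]

noncomputable instance : CoeFun (CStarSeminorm B) (fun _ => B → ℝ) := ⟨fun p => p.toSeminorm⟩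

theorem mul_le (p : CStarSeminorm B) (x y : B) : p (x * y) ≤ p x * p y := p.mul_le' x y

theorem star_mul_self (p : CStarSeminorm B) (x : B) : p (star x * x) = p x * p x :=
  p.star_mul_self' x

theorem nonneg (p : CStarSeminorm B) (x : B) : 0 ≤ p x := apply_nonneg p.toSeminorm x

theorem le_star (p : CStarSeminorm B) (x : B) : p x ≤ p (star x) := by
  have h1 := p.mul_le (star x) x
  rw [p.star_mul_self] at h1
  rcases (p.nonneg x).eq_or_lt with h | h
  · rw [← h]; exact p.nonneg _
  · exact le_of_mul_le_mul_right h1 h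

theorem star_eq (p : CStarSeminorm B) (x : B) : p (star x) = p x :=
  le_antisymm (by simpa using p.le_star (star x)) (p.le_star x)

/-- The pointwise supremum of a pointwise bounded set of C*-seminorms. -/
noncomputable def sup (S : Set (CStarSeminorm B))
    (hS : ∀ x, BddAbove (Set.range fun p : S => (p : CStarSeminorm B) x)) : CStarSeminorm B where
  toFun x := ⨆ p : S, (p : CStarSeminorm B) x
  map_zero' := by simp
  add_le' x y := by
    refine Real.iSup_le (fun p => ?_)
      (add_nonneg (Real.iSup_nonneg fun p => nonneg _ _) (Real.iSup_nonneg fun p => nonneg _ _))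
    exact (map_add_le_add p.1.toSeminorm x y).trans (add_le_add (le_ciSup (hS x) p) (le_ciSup (hS y) p))
  neg' x := by simp
  smul' c x := by
    rw [Real.mul_iSup_of_nonneg (norm_nonneg c)]
    simp [map_smul_eq_mul]
  mul_le' x y := by
    refine Real.iSup_le (fun p => ?_)
      (mul_nonneg (Real.iSup_nonneg fun p => nonneg _ _) (Real.iSup_nonneg fun p => nonneg _ _))
    exact (p.1.mul_le x y).trans (mul_le_mul (le_ciSup (hS x) p) (le_ciSup (hS y) p)
      (nonneg _ _) (Real.iSup_nonneg fun p => nonneg _ _))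
  star_mul_self' x := by
    have h0 : 0 ≤ ⨆ p : S, (p : CStarSeminorm B) x := Real.iSup_nonneg fun p => nonneg _ _
    simp only [star_mul_self]
    refine le_antisymm (Real.iSup_le (fun p => ?_) (mul_nonneg h0 h0)) ?_
    · exact mul_self_le_mul_self (nonneg _ _) (le_ciSup (hS x) p)
    · have hb : BddAbove (Set.range fun p : S => (p : CStarSeminorm B) x * (p : CStarSeminorm B) x) := by
        have := hS (star x * x)
        simpa only [star_mul_self] using this
      have hs : 0 ≤ ⨆ p : S, (p : CStarSeminorm B) x * (p : CStarSeminorm B) x :=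
        Real.iSup_nonneg fun p => mul_self_nonneg _
      have h1 : (⨆ p : S, (p : CStarSeminorm B) x) ≤
          √(⨆ p : S, (p : CStarSeminorm B) x * (p : CStarSeminorm B) x) :=
        Real.iSup_le (fun p => Real.le_sqrt_of_sq_le (by
          rw [sq]; exact le_ciSup hb p)) (Real.sqrt_nonneg _)
      exact (mul_self_le_mul_self h0 h1).trans (Real.mul_self_sqrt hs).le

theorem sup_apply (S : Set (CStarSeminorm B))
    (hS : ∀ x, BddAbove (Set.range fun p : S => (p : CStarSeminorm B) x)) (x : B) :
    sup S hS x = ⨆ p : S, (p : CStarSeminorm B) x := rfl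

/-- A C*-norm is a C*-seminorm that vanishes only at `0`. -/
def IsNorm (p : CStarSeminorm B) : Prop := ∀ x, p x = 0 → x = 0

/-- The `*`-algebra `B` regarded as a seminormed algebra by means of the C*-seminorm `p`. -/
@[nolint unusedArguments]
def Pre (_p : CStarSeminorm B) : Type _ := B

end Basic

section Pre

variable {B : Type*} [NonUnitalRing B] [Module ℂ B] [StarRing B] (p : CStarSeminorm B)

instance : NonUnitalRing p.Pre := inferInstanceAs (NonUnitalRing B)
instance : Module ℂ p.Pre := inferInstanceAs (Module ℂ B)
instance : StarRing p.Pre := inferInstanceAs (StarRing B)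
instance [IsScalarTower ℂ B B] : IsScalarTower ℂ p.Pre p.Pre :=
  inferInstanceAs (IsScalarTower ℂ B B)
instance [SMulCommClass ℂ B B] : SMulCommClass ℂ p.Pre p.Pre :=
  inferInstanceAs (SMulCommClass ℂ B B)
instance [StarModule ℂ B] : StarModule ℂ p.Pre := inferInstanceAs (StarModule ℂ B)

/-- The identity map from `B` to `p.Pre`. -/
noncomputable def toPre : B ≃ₗ[ℂ] p.Pre := LinearEquiv.refl ℂ B

noncomputable instance : SeminormedAddCommGroup p.Pre :=
  AddGroupSeminorm.toSeminormedAddCommGroup (E := p.Pre) p.toSeminorm.toAddGroupSeminorm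

theorem norm_pre (x : p.Pre) : ‖x‖ = p (p.toPre.symm x) := rfl

noncomputable instance : NonUnitalSeminormedRing p.Pre where
  __ := (inferInstance : SeminormedAddCommGroup p.Pre)
  __ := (inferInstance : NonUnitalRing p.Pre)
  norm_mul_le x y := p.mul_le x y

noncomputable instance : NormedSpace ℂ p.Pre where
  norm_smul_le c x := (map_smul_eq_mul p.toSeminorm c (p.toPre.symm x)).le

instance : NormedStarGroup p.Pre where
  norm_star_le x := (p.star_eq (p.toPre.symm x)).le

/-- The (Hausdorff) completion of a complex `*`-algebra with respect to a C*-seminorm `p`: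
the quotient by the elements with `p x = 0` is completed. -/
def Completion : Type _ := UniformSpace.Completion p.Pre

noncomputable instance : NormedAddCommGroup p.Completion :=
  inferInstanceAs (NormedAddCommGroup (UniformSpace.Completion p.Pre))
noncomputable instance : NormedSpace ℂ p.Completion :=
  inferInstanceAs (NormedSpace ℂ (UniformSpace.Completion p.Pre))
instance : CompleteSpace p.Completion :=
  inferInstanceAs (CompleteSpace (UniformSpace.Completion p.Pre))

/-- The canonical map from `p.Pre` to the completion. -/
noncomputable def mkPre (x : p.Pre) : p.Completion := (x : UniformSpace.Completion p.Pre)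

theorem isDenseInducing_mkPre : IsDenseInducing p.mkPre :=
  UniformSpace.Completion.isDenseInducing_coe

theorem continuous_mkPre : Continuous p.mkPre := p.isDenseInducing_mkPre.continuous

theorem mkPre_add (x y : p.Pre) : p.mkPre (x + y) = p.mkPre x + p.mkPre y :=
  UniformSpace.Completion.coe_add x y

theorem mkPre_zero : p.mkPre 0 = 0 := UniformSpace.Completion.coe_zero

theorem mkPre_smul (c : ℂ) (x : p.Pre) : p.mkPre (c • x) = c • p.mkPre x :=
  UniformSpace.Completion.coe_smul c x

theorem norm_mkPre (x : p.Pre) : ‖p.mkPre x‖ = ‖x‖ := UniformSpace.Completion.norm_coe x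

theorem induction_on {q : p.Completion → Prop} (x : p.Completion)
    (hc : IsClosed {x | q x}) (h : ∀ x, q (p.mkPre x)) : q x :=
  UniformSpace.Completion.induction_on x hc h

theorem induction_on₂ {q : p.Completion → p.Completion → Prop} (x y : p.Completion)
    (hc : IsClosed {z : p.Completion × p.Completion | q z.1 z.2})
    (h : ∀ x y, q (p.mkPre x) (p.mkPre y)) : q x y :=
  UniformSpace.Completion.induction_on₂ x y hc h

theorem induction_on₃ {q : p.Completion → p.Completion → p.Completion → Prop}
    (x y z : p.Completion)
    (hc : IsClosed {t : p.Completion × p.Completion × p.Completion | q t.1 t.2.1 t.2.2})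
    (h : ∀ x y z, q (p.mkPre x) (p.mkPre y) (p.mkPre z)) : q x y z :=
  UniformSpace.Completion.induction_on₃ x y z hc h

/-- The multiplication of the completion is the continuous extension of that of `B`. -/
noncomputable instance : Mul p.Completion :=
  ⟨Function.curry <| (p.isDenseInducing_mkPre.prodMap p.isDenseInducing_mkPre).extend
    (fun z : p.Pre × p.Pre => p.mkPre (z.1 * z.2))⟩

theorem mkPre_mul (x y : p.Pre) : p.mkPre (x * y) = p.mkPre x * p.mkPre y :=
  ((p.isDenseInducing_mkPre.prodMap p.isDenseInducing_mkPre).extend_eq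
    (p.continuous_mkPre.comp (continuous_mul (M := p.Pre))) (x, y)).symm

instance : ContinuousMul p.Completion where
  continuous_mul := by
    let j : p.Pre →+ p.Completion := ⟨⟨p.mkPre, p.mkPre_zero⟩, p.mkPre_add⟩
    let m := (AddMonoidHom.mul : p.Pre →+ p.Pre →+ p.Pre).compr₂ j
    have hm : Continuous fun z : p.Pre × p.Pre => m z.1 z.2 :=
      p.continuous_mkPre.comp (continuous_mul (M := p.Pre))
    have di : IsDenseInducing j := p.isDenseInducing_mkPre
    exact (di.extend_Z_bilin di hm :)

/-- The involution of the completion is the continuous extension of that of `B`. -/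
noncomputable instance : Star p.Completion :=
  ⟨UniformSpace.Completion.map (star : p.Pre → p.Pre)⟩

theorem uniformContinuous_star : UniformContinuous (star : p.Pre → p.Pre) :=
  star_isometry.uniformContinuous

theorem mkPre_star (x : p.Pre) : p.mkPre (star x) = star (p.mkPre x) :=
  (UniformSpace.Completion.map_coe p.uniformContinuous_star x).symm

instance : ContinuousStar p.Completion where
  continuous_star := UniformSpace.Completion.continuous_map

theorem completion_mul_assoc (x y z : p.Completion) : x * y * z = x * (y * z) :=
  p.induction_on₃ (q := fun x y z => x * y * z = x * (y * z)) x y z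
    (isClosed_eq (by fun_prop) (by fun_prop))
    fun x y z => by simp only [← mkPre_mul, mul_assoc]

theorem completion_mul_add (x y z : p.Completion) : x * (y + z) = x * y + x * z :=
  p.induction_on₃ (q := fun x y z => x * (y + z) = x * y + x * z) x y z
    (isClosed_eq (by fun_prop) (by fun_prop))
    fun x y z => by simp only [← mkPre_mul, ← mkPre_add, mul_add]

theorem completion_add_mul (x y z : p.Completion) : (x + y) * z = x * z + y * z :=
  p.induction_on₃ (q := fun x y z => (x + y) * z = x * z + y * z) x y z
    (isClosed_eq (by fun_prop) (by fun_prop))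
    fun x y z => by simp only [← mkPre_mul, ← mkPre_add, add_mul]

theorem completion_norm_mul_le (x y : p.Completion) : ‖x * y‖ ≤ ‖x‖ * ‖y‖ :=
  p.induction_on₂ (q := fun x y => ‖x * y‖ ≤ ‖x‖ * ‖y‖) x y
    (isClosed_le (by fun_prop) (by fun_prop))
    fun x y => by simpa only [← mkPre_mul, norm_mkPre] using norm_mul_le x y

theorem completion_star_star (x : p.Completion) : star (star x) = x :=
  p.induction_on (q := fun x => star (star x) = x) x
    (isClosed_eq (continuous_star.comp continuous_star) continuous_id) fun x => by
    simp only [← mkPre_star, star_star]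

theorem completion_star_mul (x y : p.Completion) : star (x * y) = star y * star x :=
  p.induction_on₂ (q := fun x y => star (x * y) = star y * star x) x y
    (isClosed_eq (continuous_star.comp continuous_mul)
      ((continuous_star.comp continuous_snd).mul (continuous_star.comp continuous_fst)))
    fun x y => by simp only [← mkPre_star, ← mkPre_mul, star_mul]

theorem completion_star_add (x y : p.Completion) : star (x + y) = star x + star y :=
  p.induction_on₂ (q := fun x y => star (x + y) = star x + star y) x y
    (isClosed_eq (continuous_star.comp continuous_add)
      ((continuous_star.comp continuous_fst).add (continuous_star.comp continuous_snd)))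
    fun x y => by simp only [← mkPre_star, ← mkPre_add, star_add]

theorem completion_norm_mul_self_le (x : p.Completion) : ‖x‖ * ‖x‖ ≤ ‖star x * x‖ :=
  p.induction_on (q := fun x => ‖x‖ * ‖x‖ ≤ ‖star x * x‖) x
    (isClosed_le (by fun_prop) ((continuous_star.mul continuous_id).norm)) fun x => by
    simp only [← mkPre_mul, ← mkPre_star, norm_mkPre]
    exact (p.star_mul_self (p.toPre.symm x)).ge

theorem completion_smul_mul [IsScalarTower ℂ B B] (c : ℂ) (x y : p.Completion) :
    (c • x) * y = c • (x * y) :=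
  p.induction_on₂ (q := fun x y => (c • x) * y = c • (x * y)) x y
    (isClosed_eq (((continuous_const_smul c).comp continuous_fst).mul continuous_snd)
      ((continuous_const_smul c).comp continuous_mul))
    fun x y => by rw [← mkPre_smul, ← mkPre_mul, ← mkPre_mul, ← mkPre_smul, smul_mul_assoc]

theorem completion_mul_smul [SMulCommClass ℂ B B] (c : ℂ) (x y : p.Completion) :
    x * (c • y) = c • (x * y) :=
  p.induction_on₂ (q := fun x y => x * (c • y) = c • (x * y)) x y
    (isClosed_eq (continuous_fst.mul ((continuous_const_smul c).comp continuous_snd))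
      ((continuous_const_smul c).comp continuous_mul))
    fun x y => by rw [← mkPre_smul, ← mkPre_mul, ← mkPre_mul, ← mkPre_smul, mul_smul_comm]

theorem completion_star_smul [StarModule ℂ B] (c : ℂ) (x : p.Completion) :
    star (c • x) = star c • star x :=
  p.induction_on (q := fun x => star (c • x) = star c • star x) x
    (isClosed_eq (continuous_star.comp (continuous_const_smul c))
      ((continuous_const_smul (star c)).comp continuous_star)) fun x => by
    simp only [← mkPre_smul, ← mkPre_star, star_smul]

noncomputable instance : NonUnitalNormedRing p.Completion where
  __ := (inferInstance : NormedAddCommGroup p.Completion)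
  __ := (inferInstance : Mul p.Completion)
  zero_mul x := by
    have h := p.completion_add_mul 0 0 x
    rw [add_zero] at h
    exact left_eq_add.mp h
  mul_zero x := by
    have h := p.completion_mul_add x 0 0
    rw [add_zero] at h
    exact left_eq_add.mp h
  mul_assoc := p.completion_mul_assoc
  left_distrib := p.completion_mul_add
  right_distrib := p.completion_add_mul
  norm_mul_le := p.completion_norm_mul_le

noncomputable instance : StarRing p.Completion where
  star_involutive := p.completion_star_star
  star_mul := p.completion_star_mul
  star_add := p.completion_star_add

/-- The completion with respect to a C*-seminorm is a C*-algebra. -/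
noncomputable instance [IsScalarTower ℂ B B] [SMulCommClass ℂ B B] [StarModule ℂ B] :
    NonUnitalCStarAlgebra p.Completion where
  __ := (inferInstance : NormedSpace ℂ p.Completion)
  complete := (inferInstance : CompleteSpace p.Completion).complete
  norm_mul_self_le := p.completion_norm_mul_self_le
  smul_assoc := p.completion_smul_mul
  smul_comm c x y := (p.completion_mul_smul c x y).symm
  star_smul := p.completion_star_smul

end Pre

section ToCompletion

variable {B : Type*} [NonUnitalRing B] [Module ℂ B] [StarRing B] (p : CStarSeminorm B)

/-- The canonical `*`-homomorphism from `B` to its completion. -/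
noncomputable def toCompletion : B →⋆ₙₐ[ℂ] p.Completion where
  toFun x := p.mkPre (p.toPre x)
  map_smul' c x := p.mkPre_smul c (p.toPre x)
  map_zero' := p.mkPre_zero
  map_add' x y := p.mkPre_add (p.toPre x) (p.toPre y)
  map_mul' x y := p.mkPre_mul (p.toPre x) (p.toPre y)
  map_star' x := p.mkPre_star (p.toPre x)

theorem norm_toCompletion (x : B) : ‖p.toCompletion x‖ = p x := p.norm_mkPre (p.toPre x)

theorem denseRange_toCompletion : DenseRange p.toCompletion := p.isDenseInducing_mkPre.dense

end ToCompletion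

end CStarSeminorm

/-! ### Tensor products of C*-algebras -/

section Tensor

open scoped TensorProduct

variable (A B : Type*) [NonUnitalCStarAlgebra A] [NonUnitalCStarAlgebra B]

/-- The C*-seminorms `γ` on the algebraic tensor product `A ⊗[ℂ] B` of two C*-algebras with
`γ (a ⊗ b) ≤ ‖a‖ * ‖b‖`. (Every C*-seminorm on `A ⊗[ℂ] B` has this property.) -/
def tensorSeminorms : Set (CStarSeminorm (A ⊗[ℂ] B)) :=
  {γ | ∀ a b, γ (a ⊗ₜ[ℂ] b) ≤ ‖a‖ * ‖b‖}

theorem bddAbove_tensorSeminorms (x : A ⊗[ℂ] B) :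
    BddAbove (Set.range fun γ : tensorSeminorms A B => (γ : CStarSeminorm (A ⊗[ℂ] B)) x) := by
  induction x with
  | zero => exact ⟨0, by rintro _ ⟨γ, rfl⟩; exact (map_zero γ.1.toSeminorm).le⟩
  | tmul a b => exact ⟨‖a‖ * ‖b‖, by rintro _ ⟨γ, rfl⟩; exact γ.2 a b⟩
  | add x y hx hy =>
    obtain ⟨M, hM⟩ := hx
    obtain ⟨N, hN⟩ := hy
    refine ⟨M + N, ?_⟩
    rintro _ ⟨γ, rfl⟩
    exact (map_add_le_add γ.1.toSeminorm x y).trans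
      (add_le_add (hM ⟨γ, rfl⟩) (hN ⟨γ, rfl⟩))

/-- The maximal C*-seminorm on the algebraic tensor product of two C*-algebras. -/
noncomputable def maxTensorSeminorm : CStarSeminorm (A ⊗[ℂ] B) :=
  CStarSeminorm.sup (tensorSeminorms A B) (bddAbove_tensorSeminorms A B)

/-- The (maximal) C*-tensor product of two C*-algebras. -/
abbrev MaxTensor : Type _ := (maxTensorSeminorm A B).Completion

end Tensor

/-! ### The C*-algebra of compact operators -/

section Compact

variable (H : Type*) [NormedAddCommGroup H] [InnerProductSpace ℂ H] [CompleteSpace H]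

/-- The adjoint of a compact operator on a Hilbert space is compact. -/
theorem isCompactOperator_star {H : Type*} [NormedAddCommGroup H] [InnerProductSpace ℂ H]
    [CompleteSpace H] {T : H →L[ℂ] H} (hT : IsCompactOperator T) :
    IsCompactOperator (star T : H →L[ℂ] H) := by
  have hS : IsCompactOperator (T ∘L star T) := hT.comp_clm (star T)
  change IsCompactOperator ((star T : H →L[ℂ] H) : H →ₗ[ℂ] H)
  rw [isCompactOperator_iff_isCompact_closure_image_closedBall _ zero_lt_one]
  refine TotallyBounded.isCompact_of_isClosed ?_ isClosed_closure
  refine TotallyBounded.closure ?_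
  have hS' := (hS.isCompact_closure_image_closedBall (f := ((T ∘L star T : H →L[ℂ] H) : H →ₗ[ℂ] H))
    1).totallyBounded.subset subset_closure
  rw [Metric.totallyBounded_iff] at hS' ⊢
  intro ε hε
  obtain ⟨t, ht, hcov⟩ := hS' (ε ^ 2 / 16) (by positivity)
  -- choose representatives
  have key : ∀ x ∈ Metric.closedBall (0 : H) 1, ∀ y ∈ Metric.closedBall (0 : H) 1, ∀ c : H,
      dist (T (star T x)) c < ε ^ 2 / 16 → dist (T (star T y)) c < ε ^ 2 / 16 →
      dist (star T x) (star T y) < ε := by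
    intro x hx y hy c h1 h2
    have h3 : ‖T (star T (x - y))‖ ≤ ε ^ 2 / 8 := by
      rw [map_sub, map_sub, ← dist_eq_norm]
      have := dist_triangle_right (T (star T x)) (T (star T y)) c
      linarith
    have h4 : ‖x - y‖ ≤ 2 := by
      have hx' : ‖x‖ ≤ 1 := by simpa using hx
      have hy' : ‖y‖ ≤ 1 := by simpa using hy
      linarith [norm_sub_le x y]
    have h5 : ‖star T (x - y)‖ ^ 2 ≤ ‖T (star T (x - y))‖ * ‖x - y‖ := by
      rw [← @inner_self_eq_norm_sq ℂ]
      rw [ContinuousLinearMap.star_eq_adjoint, ContinuousLinearMap.adjoint_inner_right]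
      exact (Complex.re_le_norm _).trans (norm_inner_le_norm _ _)
    have h6 : ‖star T (x - y)‖ ^ 2 < ε ^ 2 := by
      have : ‖T (star T (x - y))‖ * ‖x - y‖ ≤ ε ^ 2 / 8 * 2 :=
        mul_le_mul h3 h4 (norm_nonneg _) (by positivity)
      nlinarith [sq_pos_of_pos hε]
    rw [dist_eq_norm, ← map_sub]
    exact lt_of_pow_lt_pow_left₀ 2 hε.le h6
  classical
  let g : H → H := fun c => if h : ∃ x ∈ Metric.closedBall (0 : H) 1,
    dist (T (star T x)) c < ε ^ 2 / 16 then star T h.choose else 0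
  refine ⟨g '' t, ht.image g, ?_⟩
  rintro _ ⟨x, hx, rfl⟩
  obtain ⟨c, hc, hxc⟩ := Set.mem_iUnion₂.mp (hcov ⟨x, hx, rfl⟩)
  have hex : ∃ x ∈ Metric.closedBall (0 : H) 1, dist (T (star T x)) c < ε ^ 2 / 16 := ⟨x, hx, hxc⟩
  refine Set.mem_iUnion₂.mpr ⟨g c, ⟨c, hc, rfl⟩, ?_⟩
  have : g c = star T hex.choose := dif_pos hex
  rw [this]
  exact key x hx _ hex.choose_spec.1 c hxc hex.choose_spec.2

/-- The C*-algebra of compact operators on a Hilbert space. -/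
noncomputable def compactOperators : NonUnitalStarSubalgebra ℂ (H →L[ℂ] H) where
  carrier := {T | IsCompactOperator T}
  add_mem' := fun hS hT => hS.add hT
  zero_mem' := isCompactOperator_zero
  smul_mem' c _ hT := hT.smul c
  mul_mem' {_ T} hS _ := hS.comp_clm T
  star_mem' hT := isCompactOperator_star hT

instance : IsClosed (compactOperators H : Set (H →L[ℂ] H)) :=
  isClosed_setOfPred_isCompactOperator

end Compact

/-! ### Directed graphs and stabilizations -/

universe u v w

/-- A directed graph with countably many vertices and edges. Loops and multiple edges are
allowed. -/
structure DirectedGraph where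
  Vertex : Type u
  Edge : Type v
  source : Edge → Vertex
  range : Edge → Vertex
  countable_vertex : Countable Vertex
  countable_edge : Countable Edge

namespace DirectedGraph

/-- A vertex is regular if it emits at least one and at most finitely many edges. -/
def IsRegular (E : DirectedGraph.{u, v}) (x : E.Vertex) : Prop :=
  {e | E.source e = x}.Nonempty ∧ {e | E.source e = x}.Finite

/-- The stabilization `SE`: an infinite head `⋯ → (x, 2) → (x, 1) → (x, 0)` is attached to every
vertex `x = (x, 0)` of `E`; the edge `Sum.inr (x, n)` goes from `(x, n + 1)` to `(x, n)`. -/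
def stabilization (E : DirectedGraph.{u, v}) : DirectedGraph.{u, max u v} where
  Vertex := E.Vertex × ℕ
  Edge := E.Edge ⊕ (E.Vertex × ℕ)
  source := Sum.elim (fun e => (E.source e, 0)) (fun y => (y.1, y.2 + 1))
  range := Sum.elim (fun e => (E.range e, 0)) (fun y => y)
  countable_vertex := by
    have := E.countable_vertex
    infer_instance
  countable_edge := by
    have := E.countable_vertex
    have := E.countable_edge
    infer_instance

end DirectedGraph

/-! ### Leavitt path algebras -/

/-- The generators of the Leavitt path algebra: vertices, real edges and ghost edges. -/
inductive LeavittGenerator (E : DirectedGraph.{u, v}) : Type (max u v)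
  | vertex (x : E.Vertex)
  | edge (e : E.Edge)
  | ghost (e : E.Edge)

/-- The free associative (non-unital) algebra on the generators of the Leavitt path algebra. -/
abbrev LeavittFree (K : Type w) [Field K] (E : DirectedGraph.{u, v}) : Type (max u v w) :=
  MonoidAlgebra K (FreeSemigroup (LeavittGenerator E))

namespace LeavittFree

variable (K : Type w) [Field K] {E : DirectedGraph.{u, v}}

/-- A generator as an element of the free algebra. -/
noncomputable def gen (g : LeavittGenerator E) : LeavittFree K E :=
  MonoidAlgebra.single (FreeSemigroup.of g) 1

/-- The vertex `x` in the free algebra. -/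
noncomputable def vertex (x : E.Vertex) : LeavittFree K E := gen K (.vertex x)

/-- The real edge `e` in the free algebra. -/
noncomputable def edge (e : E.Edge) : LeavittFree K E := gen K (.edge e)

/-- The ghost edge `e*` in the free algebra. -/
noncomputable def ghost (e : E.Edge) : LeavittFree K E := gen K (.ghost e)

end LeavittFree

open LeavittFree in
/-- The defining relations of the Leavitt path algebra. -/
inductive LeavittRel (K : Type w) [Field K] (E : DirectedGraph.{u, v}) :
    LeavittFree K E → LeavittFree K E → Prop
  | vertex_idem (x : E.Vertex) : LeavittRel K E (vertex K x * vertex K x) (vertex K x)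
  | vertex_orth (x y : E.Vertex) (h : x ≠ y) : LeavittRel K E (vertex K x * vertex K y) 0
  | source_edge (e : E.Edge) : LeavittRel K E (vertex K (E.source e) * edge K e) (edge K e)
  | edge_range (e : E.Edge) : LeavittRel K E (edge K e * vertex K (E.range e)) (edge K e)
  | range_ghost (e : E.Edge) : LeavittRel K E (vertex K (E.range e) * ghost K e) (ghost K e)
  | ghost_source (e : E.Edge) : LeavittRel K E (ghost K e * vertex K (E.source e)) (ghost K e)
  | ghost_edge (e : E.Edge) : LeavittRel K E (ghost K e * edge K e) (vertex K (E.range e))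
  | ghost_edge_orth (e f : E.Edge) (h : e ≠ f) : LeavittRel K E (ghost K e * edge K f) 0
  | sum_edge_ghost (x : E.Vertex) (h : E.IsRegular x) :
      LeavittRel K E (vertex K x) (∑ e ∈ h.2.toFinset, edge K e * ghost K e)

/-- The smallest ring congruence on the free algebra that contains all scalar multiples of the
defining relations, i.e. congruence modulo the algebra ideal generated by the relations. -/
noncomputable def leavittCon (K : Type w) [Field K] (E : DirectedGraph.{u, v}) : RingCon (LeavittFree K E) :=
  ringConGen fun x y => ∃ (c : K) (a b : LeavittFree K E), LeavittRel K E a b ∧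
    x = c • a ∧ y = c • b

theorem leavittCon_smul {K : Type w} [Field K] {E : DirectedGraph.{u, v}} (c : K)
    {x y : LeavittFree K E} (h : leavittCon K E x y) : leavittCon K E (c • x) (c • y) := by
  change RingConGen.Rel _ _ _ at h ⊢
  induction h with
  | of x y h =>
    obtain ⟨d, a, b, hab, rfl, rfl⟩ := h
    exact .of _ _ ⟨c * d, a, b, hab, smul_smul _ _ _, smul_smul _ _ _⟩
  | refl x => exact .refl _
  | symm _ ih => exact .symm ih
  | trans _ _ ih1 ih2 => exact .trans ih1 ih2
  | add _ _ ih1 ih2 => rw [smul_add, smul_add]; exact .add ih1 ih2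
  | @mul w x y z h1 h2 ih1 ih2 =>
    rw [← smul_mul_assoc, ← smul_mul_assoc]; exact .mul ih1 h2

/-- The Leavitt path algebra of the graph `E` with coefficients in the field `K`, a (not
necessarily unital) associative `K`-algebra. -/
def LeavittPathAlgebra (K : Type w) [Field K] (E : DirectedGraph.{u, v}) : Type (max u v w) :=
  (leavittCon K E).Quotient

namespace LeavittPathAlgebra

section Algebra

variable (K : Type w) [Field K] {E : DirectedGraph.{u, v}}

noncomputable instance : NonUnitalRing (LeavittPathAlgebra K E) :=
  inferInstanceAs (NonUnitalRing (leavittCon K E).Quotient)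

/-- The class of an element of the free algebra. -/
noncomputable def mk (x : LeavittFree K E) : LeavittPathAlgebra K E := (leavittCon K E).toQuotient x

theorem mk_surjective : Function.Surjective (mk K (E := E)) := Quotient.mk_surjective

theorem mk_eq {x y : LeavittFree K E} : mk K x = mk K y ↔ leavittCon K E x y :=
  RingCon.eq _

theorem mk_zero : mk K (0 : LeavittFree K E) = 0 := rfl
theorem mk_add (x y : LeavittFree K E) : mk K (x + y) = mk K x + mk K y := rfl
theorem mk_mul (x y : LeavittFree K E) : mk K (x * y) = mk K x * mk K y := rfl

theorem mk_rel {x y : LeavittFree K E} (h : LeavittRel K E x y) : mk K x = mk K y :=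
  (mk_eq K).2 (.of _ _ ⟨1, x, y, h, (one_smul _ _).symm, (one_smul _ _).symm⟩)

noncomputable instance : SMul K (LeavittPathAlgebra K E) where
  smul c := Quotient.map' (c • ·) fun _ _ h => leavittCon_smul c h

theorem mk_smul (c : K) (x : LeavittFree K E) : mk K (c • x) = c • mk K x := rfl

/-- `mk` as an additive homomorphism. -/
noncomputable def mkAddHom : LeavittFree K E →+ LeavittPathAlgebra K E := ⟨⟨mk K, mk_zero K⟩, mk_add K⟩

noncomputable instance : Module K (LeavittPathAlgebra K E) :=
  Function.Surjective.module K (mkAddHom K) (mk_surjective K) (mk_smul K)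

instance : IsScalarTower K (LeavittPathAlgebra K E) (LeavittPathAlgebra K E) where
  smul_assoc c x y := by
    obtain ⟨x, rfl⟩ := mk_surjective K x
    obtain ⟨y, rfl⟩ := mk_surjective K y
    simp only [smul_eq_mul, ← mk_smul, ← mk_mul, smul_mul_assoc]

instance : SMulCommClass K (LeavittPathAlgebra K E) (LeavittPathAlgebra K E) where
  smul_comm c x y := by
    obtain ⟨x, rfl⟩ := mk_surjective K x
    obtain ⟨y, rfl⟩ := mk_surjective K y
    simp only [smul_eq_mul, ← mk_smul, ← mk_mul, mul_smul_comm]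

/-- The vertex `x` in the Leavitt path algebra. -/
noncomputable def vertex (x : E.Vertex) : LeavittPathAlgebra K E := mk K (LeavittFree.vertex K x)

/-- The real edge `e` in the Leavitt path algebra. -/
noncomputable def edge (e : E.Edge) : LeavittPathAlgebra K E := mk K (LeavittFree.edge K e)

/-- The ghost edge `e*` in the Leavitt path algebra. -/
noncomputable def ghost (e : E.Edge) : LeavittPathAlgebra K E := mk K (LeavittFree.ghost K e)

theorem induction {q : LeavittPathAlgebra K E → Prop} (hv : ∀ x, q (vertex K x))
    (he : ∀ e, q (edge K e)) (hg : ∀ e, q (ghost K e)) (h0 : q 0)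
    (hadd : ∀ x y, q x → q y → q (x + y)) (hmul : ∀ x y, q x → q y → q (x * y))
    (hsmul : ∀ (c : K) x, q x → q (c • x)) (x : LeavittPathAlgebra K E) : q x := by
  have hgen : ∀ g, q (mk K (LeavittFree.gen K g)) := by
    rintro (x | e | e)
    exacts [hv x, he e, hg e]
  have hword : ∀ s : FreeSemigroup (LeavittGenerator E), q (mk K (MonoidAlgebra.single s 1)) := by
    intro s
    induction s using FreeSemigroup.recOnMul with
    | ih1 g => exact hgen g
    | ih2 g s h1 h2 =>
      have : (MonoidAlgebra.single (FreeSemigroup.of g * s) 1 : LeavittFree K E) =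
          MonoidAlgebra.single (FreeSemigroup.of g) 1 * MonoidAlgebra.single s 1 := by
        rw [MonoidAlgebra.single_mul_single, one_mul]
      rw [this, mk_mul]
      exact hmul _ _ h1 h2
  obtain ⟨x, rfl⟩ := mk_surjective K x
  induction x using MonoidAlgebra.induction_linear with
  | zero => exact h0
  | add x y hx hy => exact hadd _ _ hx hy
  | single s c =>
    have : (MonoidAlgebra.single s c : LeavittFree K E) = c • MonoidAlgebra.single s 1 := by
      rw [MonoidAlgebra.smul_single, smul_eq_mul, mul_one]
    rw [this, mk_smul]
    exact hsmul _ _ (hword s)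

end Algebra

/-! The involution for a field with involution; for `ℂ` it is conjugate-linear. -/

section Star

variable (K : Type w) [Field K] [StarRing K] {E : DirectedGraph.{u, v}}

/-- The involution on generators: vertices are fixed, real and ghost edges are exchanged. -/
def starGen : LeavittGenerator E → LeavittGenerator E
  | .vertex x => .vertex x
  | .edge e => .ghost e
  | .ghost e => .edge e

/-- The involution on words in the generators: it reverses the order. -/
def starWord : FreeSemigroup (LeavittGenerator E) →ₙ* (FreeSemigroup (LeavittGenerator E))ᵐᵒᵖ :=
  FreeSemigroup.lift fun g => MulOpposite.op (FreeSemigroup.of (starGen g))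

theorem starWord_starWord (s : FreeSemigroup (LeavittGenerator E)) :
    (starWord (starWord s).unop).unop = s := by
  induction s using FreeSemigroup.recOnMul with
  | ih1 g => rcases g with x | e | e <;> rfl
  | ih2 g s h1 h2 => rw [map_mul, MulOpposite.unop_mul, map_mul, MulOpposite.unop_mul, h1, h2]

/-- The conjugate-linear involution on the free algebra. -/
noncomputable def starFree : LeavittFree K E →+ LeavittFree K E :=
  (Finsupp.liftAddHom fun s => (MonoidAlgebra.singleAddHom (starWord s).unop).comp
    (starAddEquiv (R := K)).toAddMonoidHom).comp MonoidAlgebra.coeffAddEquiv.toAddMonoidHom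

theorem starFree_single (s : FreeSemigroup (LeavittGenerator E)) (c : K) :
    starFree K (MonoidAlgebra.single s c) =
      MonoidAlgebra.single (starWord s).unop (star c) := by
  simp [starFree]

theorem starFree_smul (c : K) (x : LeavittFree K E) :
    starFree K (c • x) = star c • starFree K x := by
  induction x using MonoidAlgebra.induction_linear with
  | zero => simp
  | add x y hx hy => rw [smul_add, map_add, map_add, smul_add, hx, hy]
  | single s d =>
    rw [MonoidAlgebra.smul_single, starFree_single, starFree_single, MonoidAlgebra.smul_single,
      smul_eq_mul, smul_eq_mul, star_mul, mul_comm]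

theorem starFree_mul (x y : LeavittFree K E) :
    starFree K (x * y) = starFree K y * starFree K x := by
  induction x using MonoidAlgebra.induction_linear with
  | zero => simp
  | add x x' hx hx' => rw [add_mul, map_add, map_add, mul_add, hx, hx']
  | single s c =>
    induction y using MonoidAlgebra.induction_linear with
    | zero => simp
    | add y y' hy hy' => rw [mul_add, map_add, map_add, add_mul, hy, hy']
    | single t d =>
      rw [MonoidAlgebra.single_mul_single, starFree_single, starFree_single, starFree_single,
        MonoidAlgebra.single_mul_single, map_mul, MulOpposite.unop_mul, star_mul]

theorem starFree_starFree (x : LeavittFree K E) : starFree K (starFree K x) = x := by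
  induction x using MonoidAlgebra.induction_linear with
  | zero => simp
  | add x y hx hy => rw [map_add, map_add, hx, hy]
  | single s c => rw [starFree_single, starFree_single, star_star, starWord_starWord]

theorem starFree_vertex (x : E.Vertex) :
    starFree K (LeavittFree.vertex K x) = LeavittFree.vertex K x := by
  simp only [LeavittFree.vertex, LeavittFree.gen, starFree_single, star_one]; rfl

theorem starFree_edge (e : E.Edge) :
    starFree K (LeavittFree.edge K e) = LeavittFree.ghost K e := by
  simp only [LeavittFree.edge, LeavittFree.ghost, LeavittFree.gen, starFree_single, star_one]; rfl

theorem starFree_ghost (e : E.Edge) :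
    starFree K (LeavittFree.ghost K e) = LeavittFree.edge K e := by
  simp only [LeavittFree.edge, LeavittFree.ghost, LeavittFree.gen, starFree_single, star_one]; rfl

theorem starFree_rel {a b : LeavittFree K E} (h : LeavittRel K E a b) :
    LeavittRel K E (starFree K a) (starFree K b) := by
  cases h with
  | vertex_idem x => simpa only [starFree_mul, starFree_vertex] using .vertex_idem x
  | vertex_orth x y h =>
    simpa only [starFree_mul, starFree_vertex, map_zero] using .vertex_orth y x h.symm
  | source_edge e =>
    simpa only [starFree_mul, starFree_vertex, starFree_edge] using .ghost_source e
  | edge_range e =>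
    simpa only [starFree_mul, starFree_vertex, starFree_edge] using .range_ghost e
  | range_ghost e =>
    simpa only [starFree_mul, starFree_vertex, starFree_ghost] using .edge_range e
  | ghost_source e =>
    simpa only [starFree_mul, starFree_vertex, starFree_ghost] using .source_edge e
  | ghost_edge e =>
    simpa only [starFree_mul, starFree_vertex, starFree_ghost, starFree_edge] using .ghost_edge e
  | ghost_edge_orth e f h =>
    simpa only [starFree_mul, starFree_ghost, starFree_edge, map_zero] using
      .ghost_edge_orth f e h.symm
  | sum_edge_ghost x h =>
    simpa only [map_sum, starFree_mul, starFree_vertex, starFree_ghost, starFree_edge] using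
      .sum_edge_ghost x h

theorem starFree_con {x y : LeavittFree K E} (h : leavittCon K E x y) :
    leavittCon K E (starFree K x) (starFree K y) := by
  change RingConGen.Rel _ _ _ at h ⊢
  induction h with
  | of x y h =>
    obtain ⟨c, a, b, hab, rfl, rfl⟩ := h
    exact .of _ _ ⟨star c, _, _, starFree_rel K hab, starFree_smul K _ _, starFree_smul K _ _⟩
  | refl x => exact .refl _
  | symm _ ih => exact .symm ih
  | trans _ _ ih1 ih2 => exact .trans ih1 ih2
  | add _ _ ih1 ih2 => rw [map_add, map_add]; exact .add ih1 ih2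
  | mul _ _ ih1 ih2 => rw [starFree_mul, starFree_mul]; exact .mul ih2 ih1

noncomputable instance : Star (LeavittPathAlgebra K E) where
  star := Quotient.map' (starFree K) fun _ _ h => starFree_con K h

theorem mk_star (x : LeavittFree K E) : mk K (starFree K x) = star (mk K x) := rfl

noncomputable instance : StarRing (LeavittPathAlgebra K E) where
  star_involutive x := by
    obtain ⟨x, rfl⟩ := mk_surjective K x
    rw [← mk_star, ← mk_star, starFree_starFree]
  star_mul x y := by
    obtain ⟨x, rfl⟩ := mk_surjective K x
    obtain ⟨y, rfl⟩ := mk_surjective K y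
    rw [← mk_mul, ← mk_star, ← mk_star, ← mk_star, ← mk_mul, starFree_mul]
  star_add x y := by
    obtain ⟨x, rfl⟩ := mk_surjective K x
    obtain ⟨y, rfl⟩ := mk_surjective K y
    rw [← mk_add, ← mk_star, ← mk_star, ← mk_star, ← mk_add, map_add]

instance : StarModule K (LeavittPathAlgebra K E) where
  star_smul c x := by
    obtain ⟨x, rfl⟩ := mk_surjective K x
    rw [← mk_smul, ← mk_star, ← mk_star, ← mk_smul, starFree_smul]

theorem star_vertex (x : E.Vertex) : star (vertex K x) = vertex K x := by
  rw [vertex, ← mk_star, starFree_vertex]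

theorem star_edge (e : E.Edge) : star (edge K e) = ghost K e := by
  rw [edge, ← mk_star, starFree_edge]; rfl

theorem star_ghost (e : E.Edge) : star (ghost K e) = edge K e := by
  rw [ghost, ← mk_star, starFree_ghost]; rfl

end Star

end LeavittPathAlgebra

/-! ### Graph C*-algebras -/

section GraphCStar

variable (E : DirectedGraph.{u, v})

theorem bddAbove_leavitt_cstarSeminorm (x : LeavittPathAlgebra ℂ E) :
    BddAbove (Set.range fun p : (Set.univ : Set (CStarSeminorm (LeavittPathAlgebra ℂ E))) =>
      (p : CStarSeminorm (LeavittPathAlgebra ℂ E)) x) := by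
  suffices h : ∃ M, ∀ p : CStarSeminorm (LeavittPathAlgebra ℂ E), p x ≤ M by
    obtain ⟨M, hM⟩ := h
    exact ⟨M, by rintro _ ⟨p, rfl⟩; exact hM p⟩
  have hv : ∀ (y : E.Vertex) (p : CStarSeminorm (LeavittPathAlgebra ℂ E)),
      p (LeavittPathAlgebra.vertex ℂ y) ≤ 1 := by
    intro y p
    have h1 := p.star_mul_self (LeavittPathAlgebra.vertex ℂ y)
    have h2 : LeavittPathAlgebra.vertex ℂ y * LeavittPathAlgebra.vertex ℂ y =
        LeavittPathAlgebra.vertex ℂ y := LeavittPathAlgebra.mk_rel ℂ (.vertex_idem y)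
    rw [LeavittPathAlgebra.star_vertex, h2] at h1
    nlinarith [p.nonneg (LeavittPathAlgebra.vertex ℂ y)]
  have he : ∀ (e : E.Edge) (p : CStarSeminorm (LeavittPathAlgebra ℂ E)),
      p (LeavittPathAlgebra.edge ℂ e) ≤ 1 := by
    intro e p
    have h1 := p.star_mul_self (LeavittPathAlgebra.edge ℂ e)
    have h2 : LeavittPathAlgebra.ghost ℂ e * LeavittPathAlgebra.edge ℂ e =
        LeavittPathAlgebra.vertex ℂ (E.range e) := LeavittPathAlgebra.mk_rel ℂ (.ghost_edge e)
    rw [LeavittPathAlgebra.star_edge, h2] at h1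
    nlinarith [p.nonneg (LeavittPathAlgebra.edge ℂ e), hv (E.range e) p]
  induction x using LeavittPathAlgebra.induction with
  | hv y => exact ⟨1, hv y⟩
  | he e => exact ⟨1, he e⟩
  | hg e =>
    refine ⟨1, fun p => ?_⟩
    rw [← LeavittPathAlgebra.star_edge, p.star_eq]
    exact he e p
  | h0 => exact ⟨0, fun p => (map_zero p.toSeminorm).le⟩
  | hadd x y hx hy =>
    obtain ⟨M, hM⟩ := hx
    obtain ⟨N, hN⟩ := hy
    exact ⟨M + N, fun p => (map_add_le_add p.toSeminorm x y).trans (add_le_add (hM p) (hN p))⟩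
  | hmul x y hx hy =>
    obtain ⟨M, hM⟩ := hx
    obtain ⟨N, hN⟩ := hy
    exact ⟨M * N, fun p => (p.mul_le x y).trans
      (mul_le_mul (hM p) (hN p) (p.nonneg y) ((p.nonneg x).trans (hM p)))⟩
  | hsmul c x hx =>
    obtain ⟨M, hM⟩ := hx
    exact ⟨‖c‖ * M, fun p => (map_smul_eq_mul p.toSeminorm c x).le.trans
      (mul_le_mul_of_nonneg_left (hM p) (norm_nonneg c))⟩

/-- The largest C*-seminorm on the complex Leavitt path algebra. -/
noncomputable def graphCStarSeminorm : CStarSeminorm (LeavittPathAlgebra ℂ E) :=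
  CStarSeminorm.sup Set.univ (bddAbove_leavitt_cstarSeminorm E)

/-- The graph C*-algebra of `E`, constructed as the completion of the complex Leavitt path algebra
(the `*`-algebra generated by a universal Cuntz–Krieger family) in its largest C*-seminorm. That it
is the universal C*-algebra generated by a Cuntz–Krieger `E`-family is proved below, in
`GraphCStarAlgebra.isCuntzKriegerFamily` and `GraphCStarAlgebra.exists_unique_hom`. -/
abbrev GraphCStarAlgebra : Type (max u v) := (graphCStarSeminorm E).Completion

end GraphCStar

/-- A Cuntz–Krieger `E`-family in a `*`-ring: mutually orthogonal projections `P x` and partial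
isometries `S e` with mutually orthogonal ranges which satisfy the Cuntz–Krieger relations. -/
structure IsCuntzKriegerFamily (E : DirectedGraph.{u, v}) {A : Type*} [NonUnitalRing A]
    [StarRing A] (P : E.Vertex → A) (S : E.Edge → A) : Prop where
  star_vertex : ∀ x, star (P x) = P x
  vertex_mul_self : ∀ x, P x * P x = P x
  vertex_orth : ∀ x y, x ≠ y → P x * P y = 0
  partial_isometry : ∀ e, S e * star (S e) * S e = S e
  range_orth : ∀ e f, e ≠ f → star (S e) * S f = 0
  star_mul_self : ∀ e, star (S e) * S e = P (E.range e)
  sum_mul_star : ∀ x (h : E.IsRegular x), P x = ∑ e ∈ h.2.toFinset, S e * star (S e)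
  le_source : ∀ e, P (E.source e) * (S e * star (S e)) = S e * star (S e)

namespace GraphCStarAlgebra

variable {E : DirectedGraph.{u, v}}

/-- The projection in the graph C*-algebra given by a vertex. -/
noncomputable def vertex (x : E.Vertex) : GraphCStarAlgebra E :=
  (graphCStarSeminorm E).toCompletion (LeavittPathAlgebra.vertex ℂ x)

/-- The partial isometry in the graph C*-algebra given by an edge. -/
noncomputable def edge (e : E.Edge) : GraphCStarAlgebra E :=
  (graphCStarSeminorm E).toCompletion (LeavittPathAlgebra.edge ℂ e)

end GraphCStarAlgebra

/-! ### The universal property of the graph C*-algebra -/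

namespace CStarSeminorm

variable {B : Type*} [NonUnitalRing B] [Module ℂ B] [StarRing B]

/-- The C*-seminorm given by a `*`-homomorphism to a C*-algebra. -/
noncomputable def ofHom {A : Type*} [NonUnitalCStarAlgebra A] (φ : B →⋆ₙₐ[ℂ] A) :
    CStarSeminorm B where
  toFun x := ‖φ x‖
  map_zero' := by simp
  add_le' x y := by rw [map_add]; exact norm_add_le _ _
  neg' x := by
    have : φ (-x) = -φ x := map_neg φ x
    rw [this, norm_neg]
  smul' c x := by rw [map_smul, norm_smul]
  mul_le' x y := by rw [map_mul]; exact norm_mul_le _ _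
  star_mul_self' x := by rw [map_mul, map_star, CStarRing.norm_star_mul_self]

theorem ofHom_apply {A : Type*} [NonUnitalCStarAlgebra A] (φ : B →⋆ₙₐ[ℂ] A) (x : B) :
    ofHom φ x = ‖φ x‖ := rfl

/-- A `*`-homomorphism dominated by a C*-seminorm extends to the completion. -/
theorem exists_extension (p : CStarSeminorm B) {A : Type*} [NonUnitalCStarAlgebra A]
    (φ : B →⋆ₙₐ[ℂ] A) (h : ∀ x, ‖φ x‖ ≤ p x) :
    ∃ ψ : p.Completion →⋆ₙₐ[ℂ] A, Continuous ψ ∧ ∀ x, ψ (p.toCompletion x) = φ x := by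
  let f : p.Pre →+ A := ⟨⟨fun x => φ (p.toPre.symm x), map_zero φ⟩, fun x y => map_add φ _ _⟩
  have hf : UniformContinuous f := by
    refine (AddMonoidHomClass.lipschitz_of_bound f 1 fun x => ?_).uniformContinuous
    rw [one_mul]
    exact h (p.toPre.symm x)
  let g : p.Completion → A := UniformSpace.Completion.extension f
  have hg : Continuous g := UniformSpace.Completion.continuous_extension
  have hgx : ∀ x : p.Pre, g (p.mkPre x) = f x := UniformSpace.Completion.extension_coe hf
  refine ⟨{ toFun := g, map_smul' := ?_, map_zero' := ?_, map_add' := ?_, map_mul' := ?_,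
            map_star' := ?_ }, hg, fun x => hgx (p.toPre x)⟩
  · intro c x
    refine p.induction_on (q := fun x => g (c • x) = c • g x) x
      (isClosed_eq (hg.comp (continuous_const_smul c)) ((continuous_const_smul c).comp hg))
      fun x => ?_
    rw [← mkPre_smul, hgx, hgx]
    exact map_smul φ c (p.toPre.symm x)
  · rw [← p.mkPre_zero, hgx, map_zero]
  · intro x y
    refine p.induction_on₂ (q := fun x y => g (x + y) = g x + g y) x y
      (isClosed_eq (hg.comp continuous_add) ((hg.comp continuous_fst).add (hg.comp continuous_snd)))
      fun x y => ?_
    rw [← mkPre_add, hgx, hgx, hgx, map_add]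
  · intro x y
    refine p.induction_on₂ (q := fun x y => g (x * y) = g x * g y) x y
      (isClosed_eq (hg.comp continuous_mul) ((hg.comp continuous_fst).mul (hg.comp continuous_snd)))
      fun x y => ?_
    rw [← mkPre_mul, hgx, hgx, hgx]
    exact map_mul φ (p.toPre.symm x) (p.toPre.symm y)
  · intro x
    refine p.induction_on (q := fun x => g (star x) = star (g x)) x
      (isClosed_eq (hg.comp continuous_star) (continuous_star.comp hg)) fun x => ?_
    rw [← mkPre_star, hgx, hgx]
    exact map_star φ (p.toPre.symm x)

end CStarSeminorm

namespace LeavittPathAlgebra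

/-- A map on generators that respects the defining relations extends to the Leavitt path
algebra. -/
theorem exists_lift {K : Type w} [Field K] {E : DirectedGraph.{u, v}} {A : Type*}
    [NonUnitalRing A] [Module K A] [IsScalarTower K A A] [SMulCommClass K A A]
    (f : LeavittGenerator E → A)
    (h : ∀ x y, LeavittRel K E x y →
      MonoidAlgebra.liftMagma K (FreeSemigroup.lift f) x =
        MonoidAlgebra.liftMagma K (FreeSemigroup.lift f) y) :
    ∃ φ : LeavittPathAlgebra K E →ₙₐ[K] A, ∀ x,
      φ (mk K x) = MonoidAlgebra.liftMagma K (FreeSemigroup.lift f) x := by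
  set F := MonoidAlgebra.liftMagma K (FreeSemigroup.lift f) with hF
  have hcon : ∀ x y, leavittCon K E x y → F x = F y := by
    intro x y hxy
    change RingConGen.Rel _ _ _ at hxy
    induction hxy with
    | of x y hxy =>
      obtain ⟨c, a, b, hab, rfl, rfl⟩ := hxy
      rw [map_smul, map_smul, h _ _ hab]
    | refl x => rfl
    | symm _ ih => exact ih.symm
    | trans _ _ ih1 ih2 => exact ih1.trans ih2
    | add _ _ ih1 ih2 => rw [map_add, map_add, ih1, ih2]
    | mul _ _ ih1 ih2 => rw [map_mul, map_mul, ih1, ih2]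
  let g : LeavittPathAlgebra K E → A := Quotient.lift F hcon
  have hg : ∀ x, g (mk K x) = F x := fun x => rfl
  refine ⟨{ toFun := g, map_smul' := ?_, map_zero' := map_zero F, map_add' := ?_,
            map_mul' := ?_ }, hg⟩
  · intro c x
    obtain ⟨x, rfl⟩ := mk_surjective K x
    exact map_smul F c x
  · intro x y
    obtain ⟨x, rfl⟩ := mk_surjective K x
    obtain ⟨y, rfl⟩ := mk_surjective K y
    exact map_add F x y
  · intro x y
    obtain ⟨x, rfl⟩ := mk_surjective K x
    obtain ⟨y, rfl⟩ := mk_surjective K y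
    exact map_mul F x y

end LeavittPathAlgebra

namespace GraphCStarAlgebra

variable {E : DirectedGraph.{u, v}}

/-- The graph C*-algebra contains a canonical Cuntz–Krieger family. -/
theorem isCuntzKriegerFamily :
    IsCuntzKriegerFamily E (vertex (E := E)) (edge (E := E)) := by
  have hst : ∀ e : E.Edge, star (edge e) =
      (graphCStarSeminorm E).toCompletion (LeavittPathAlgebra.ghost ℂ e) := fun e => by
    rw [edge, ← map_star, LeavittPathAlgebra.star_edge]
  have hrel : ∀ {a b}, LeavittRel ℂ E a b →
      (graphCStarSeminorm E).toCompletion (LeavittPathAlgebra.mk ℂ a) =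
      (graphCStarSeminorm E).toCompletion (LeavittPathAlgebra.mk ℂ b) := fun h => by
    rw [LeavittPathAlgebra.mk_rel ℂ h]
  have hsm : ∀ e : E.Edge, star (edge e) * edge e = vertex (E.range e) := fun e => by
    rw [hst, edge, ← map_mul]; exact hrel (.ghost_edge e)
  have hse : ∀ e : E.Edge, vertex (E.source e) * edge e = edge e := fun e => by
    rw [edge, vertex, ← map_mul]; exact hrel (.source_edge e)
  have her : ∀ e : E.Edge, edge e * vertex (E.range e) = edge e := fun e => by
    rw [edge, vertex, ← map_mul]; exact hrel (.edge_range e)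
  constructor
  · intro x
    rw [vertex, ← map_star, LeavittPathAlgebra.star_vertex]
  · intro x
    rw [vertex, ← map_mul]; exact hrel (.vertex_idem x)
  · intro x y h
    rw [vertex, vertex, ← map_mul]; exact (hrel (.vertex_orth x y h)).trans (map_zero _)
  · intro e
    rw [mul_assoc, hsm, her]
  · intro e f h
    rw [hst, edge, ← map_mul]; exact (hrel (.ghost_edge_orth e f h)).trans (map_zero _)
  · exact hsm
  · intro x h
    simp only [hst]
    simp only [edge, ← map_mul, ← map_sum]
    refine (hrel (.sum_edge_ghost x h)).trans (congrArg _ ?_)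
    exact map_sum (LeavittPathAlgebra.mkAddHom ℂ) _ _
  · intro e
    rw [← mul_assoc, hse]

open scoped CStarAlgebra in
/-- The universal property of the graph C*-algebra. -/
theorem exists_unique_hom {A : Type*} [NonUnitalCStarAlgebra A] {P : E.Vertex → A}
    {S : E.Edge → A} (h : IsCuntzKriegerFamily E P S) :
    ∃! φ : GraphCStarAlgebra E →⋆ₙₐ[ℂ] A, (∀ x, φ (vertex x) = P x) ∧ ∀ e, φ (edge e) = S e := by
  have hsource : ∀ e, P (E.source e) * S e = S e := fun e => by
    rw [← h.partial_isometry e, ← mul_assoc, h.le_source]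
  have hrange : ∀ e, S e * P (E.range e) = S e := fun e => by
    rw [← h.star_mul_self, ← mul_assoc, h.partial_isometry]
  obtain ⟨φ₀, hφ₀⟩ := LeavittPathAlgebra.exists_lift (K := ℂ) (E := E) (A := A)
    (fun | .vertex x => P x | .edge e => S e | .ghost e => star (S e)) (by
      intro a b hab
      have hgen : ∀ (f : LeavittGenerator E → A) g, MonoidAlgebra.liftMagma ℂ
          (FreeSemigroup.lift f) (LeavittFree.gen ℂ g) = f g := fun f g => by
        simp [LeavittFree.gen, MonoidAlgebra.liftMagma]
      cases hab <;>
        simp only [map_mul, map_zero, map_sum, LeavittFree.vertex, LeavittFree.edge,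
          LeavittFree.ghost, hgen]
      · exact h.vertex_mul_self _
      · exact h.vertex_orth _ _ ‹_›
      · exact hsource _
      · exact hrange _
      · rw [← h.star_vertex, ← star_mul, hrange]
      · rw [← h.star_vertex, ← star_mul, hsource]
      · exact h.star_mul_self _
      · exact h.range_orth _ _ ‹_›
      · exact h.sum_mul_star _ ‹_›)
  have hgen : ∀ g, φ₀ (LeavittPathAlgebra.mk ℂ (LeavittFree.gen ℂ g)) =
      (fun | .vertex x => P x | .edge e => S e | .ghost e => star (S e) :
        LeavittGenerator E → A) g := fun g => by
    rw [hφ₀]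
    simp [LeavittFree.gen, MonoidAlgebra.liftMagma]
  have hV : ∀ x, φ₀ (LeavittPathAlgebra.vertex ℂ x) = P x := fun x => hgen (.vertex x)
  have hE : ∀ e, φ₀ (LeavittPathAlgebra.edge ℂ e) = S e := fun e => hgen (.edge e)
  have hG : ∀ e, φ₀ (LeavittPathAlgebra.ghost ℂ e) = star (S e) := fun e => hgen (.ghost e)
  have hstar : ∀ x, φ₀ (star x) = star (φ₀ x) := by
    intro x
    induction x using LeavittPathAlgebra.induction with
    | hv x => rw [LeavittPathAlgebra.star_vertex, hV, h.star_vertex]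
    | he e => rw [LeavittPathAlgebra.star_edge, hE, hG]
    | hg e => rw [LeavittPathAlgebra.star_ghost, hE, hG, star_star]
    | h0 => simp
    | hadd x y hx hy => rw [star_add, map_add, map_add, star_add, hx, hy]
    | hmul x y hx hy => rw [star_mul, map_mul, map_mul, star_mul, hx, hy]
    | hsmul c x hx => rw [star_smul, map_smul, map_smul, star_smul, hx]
  let φ₁ : LeavittPathAlgebra ℂ E →⋆ₙₐ[ℂ] A := { φ₀ with map_star' := hstar }
  obtain ⟨φ, hφc, hφ⟩ := (graphCStarSeminorm E).exists_extension φ₁ fun x =>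
    le_ciSup (bddAbove_leavitt_cstarSeminorm E x) ⟨CStarSeminorm.ofHom φ₁, trivial⟩
  refine ⟨φ, ⟨fun x => (hφ _).trans (hV x), fun e => (hφ _).trans (hE e)⟩, ?_⟩
  rintro ψ ⟨hψV, hψE⟩
  have hψc : Continuous ψ := map_continuous ψ
  refine DFunLike.coe_injective ((graphCStarSeminorm E).denseRange_toCompletion.equalizer hψc hφc ?_)
  funext x
  simp only [Function.comp_apply, hφ]
  change _ = φ₀ x
  induction x using LeavittPathAlgebra.induction with
  | hv x => rw [hV]; exact hψV x
  | he e => rw [hE]; exact hψE e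
  | hg e =>
    rw [hG, ← LeavittPathAlgebra.star_edge, map_star, map_star, ← hψE e]; rfl
  | h0 => simp
  | hadd x y hx hy => rw [map_add, map_add, map_add, hx, hy]
  | hmul x y hx hy => rw [map_mul, map_mul, map_mul, hx, hy]
  | hsmul c x hx => rw [map_smul, map_smul, map_smul, hx]

end GraphCStarAlgebra

/-! ### Infinite matrices with finite support -/

/-- `MInfty R` is the ring `M_∞(R)` of finitely supported matrices with entries in `R`, with rows
and columns indexed by `ℕ`. -/
@[ext]
structure MInfty (R : Type*) [Zero R] where
  entry : ℕ → ℕ → R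
  finite_support : {ij : ℕ × ℕ | entry ij.1 ij.2 ≠ 0}.Finite

namespace MInfty

section Zero

variable {R : Type*} [Zero R]

theorem exists_bound (A : MInfty R) : ∃ N, ∀ i j, N ≤ i ∨ N ≤ j → A.entry i j = 0 := by
  obtain ⟨N, hN⟩ := (A.finite_support.image fun ij => max ij.1 ij.2).bddAbove
  refine ⟨N + 1, fun i j hij => ?_⟩
  by_contra h
  have h1 : max i j ≤ N := hN ⟨(i, j), h, rfl⟩
  have h2 := le_max_left i j
  have h3 := le_max_right i j
  omega

theorem finite_of_bound {f : ℕ → ℕ → R} (N : ℕ) (h : ∀ i j, N ≤ i ∨ N ≤ j → f i j = 0) :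
    {ij : ℕ × ℕ | f ij.1 ij.2 ≠ 0}.Finite := by
  refine ((Set.finite_Iio N).prod (Set.finite_Iio N)).subset ?_
  rintro ⟨i, j⟩ hij
  by_contra hn
  refine hij (h i j ?_)
  simp only [Set.mem_prod, Set.mem_Iio] at hn
  omega

instance : Zero (MInfty R) := ⟨⟨fun _ _ => 0, finite_of_bound 0 fun _ _ _ => rfl⟩⟩

@[simp] theorem zero_entry (i j : ℕ) : (0 : MInfty R).entry i j = 0 := rfl

end Zero

section Ring

variable {R : Type*} [NonUnitalRing R]

instance : Add (MInfty R) where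
  add A B := ⟨fun i j => A.entry i j + B.entry i j, by
    obtain ⟨M, hM⟩ := A.exists_bound
    obtain ⟨N, hN⟩ := B.exists_bound
    refine finite_of_bound (f := fun i j => A.entry i j + B.entry i j) (max M N) fun i j h => ?_
    rw [hM i j (by omega), hN i j (by omega), add_zero]⟩

instance : Neg (MInfty R) where
  neg A := ⟨fun i j => -A.entry i j, by
    obtain ⟨M, hM⟩ := A.exists_bound
    exact finite_of_bound (f := fun i j => -A.entry i j) M fun i j h => by rw [hM i j h, neg_zero]⟩

/-- Matrix multiplication; the sum over `j` has only finitely many non-zero terms. -/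
noncomputable instance : Mul (MInfty R) where
  mul A B := ⟨fun i k => ∑ᶠ j, A.entry i j * B.entry j k, by
    obtain ⟨M, hM⟩ := A.exists_bound
    obtain ⟨N, hN⟩ := B.exists_bound
    refine finite_of_bound (f := fun i k => ∑ᶠ j, A.entry i j * B.entry j k) (max M N) fun i k h => ?_
    refine (finsum_congr fun j => ?_).trans finsum_zero
    rcases h with h | h
    · rw [hM i j (by omega), zero_mul]
    · rw [hN j k (by omega), mul_zero]⟩

@[simp] theorem add_entry (A B : MInfty R) (i j : ℕ) :
    (A + B).entry i j = A.entry i j + B.entry i j := rfl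

@[simp] theorem neg_entry (A : MInfty R) (i j : ℕ) : (-A).entry i j = -A.entry i j := rfl

theorem mul_entry (A B : MInfty R) (i k : ℕ) :
    (A * B).entry i k = ∑ᶠ j, A.entry i j * B.entry j k := rfl

theorem mul_entry_left {A : MInfty R} {N : ℕ} (hA : ∀ i j, N ≤ i ∨ N ≤ j → A.entry i j = 0)
    (B : MInfty R) (i k : ℕ) :
    (A * B).entry i k = ∑ j ∈ Finset.range N, A.entry i j * B.entry j k := by
  rw [mul_entry]
  refine finsum_eq_sum_of_support_subset _ fun j hj => ?_
  by_contra hn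
  refine hj ?_
  simp only [Finset.coe_range, Set.mem_Iio, not_lt] at hn
  simp only [hA i j (Or.inr hn), zero_mul]

theorem mul_entry_right (A : MInfty R) {B : MInfty R} {N : ℕ}
    (hB : ∀ i j, N ≤ i ∨ N ≤ j → B.entry i j = 0) (i k : ℕ) :
    (A * B).entry i k = ∑ j ∈ Finset.range N, A.entry i j * B.entry j k := by
  rw [mul_entry]
  refine finsum_eq_sum_of_support_subset _ fun j hj => ?_
  by_contra hn
  refine hj ?_
  simp only [Finset.coe_range, Set.mem_Iio, not_lt] at hn
  simp only [hB j k (Or.inl hn), mul_zero]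

noncomputable instance : NonUnitalRing (MInfty R) where
  add_assoc A B C := by ext i j; exact add_assoc _ _ _
  zero_add A := by ext i j; exact zero_add _
  add_zero A := by ext i j; exact add_zero _
  add_comm A B := by ext i j; exact add_comm _ _
  neg_add_cancel A := by ext i j; exact neg_add_cancel _
  nsmul := nsmulRec
  zsmul := zsmulRec
  zero_mul A := by
    ext i k
    simp [mul_entry]
  mul_zero A := by
    ext i k
    simp [mul_entry]
  left_distrib A B C := by
    ext i k
    obtain ⟨N, hN⟩ := A.exists_bound
    simp only [add_entry, mul_entry_left hN, mul_add, Finset.sum_add_distrib]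
  right_distrib A B C := by
    ext i k
    obtain ⟨N, hN⟩ := C.exists_bound
    simp only [add_entry, mul_entry_right _ hN, add_mul, Finset.sum_add_distrib]
  mul_assoc A B C := by
    ext i k
    obtain ⟨M, hM⟩ := A.exists_bound
    obtain ⟨N, hN⟩ := C.exists_bound
    rw [mul_entry_right _ hN, mul_entry_left hM]
    simp only [mul_entry_left hM, mul_entry_right _ hN, Finset.sum_mul, Finset.mul_sum, mul_assoc]
    exact Finset.sum_comm

end Ring

section Module

variable {K R : Type*} [Semiring K] [NonUnitalRing R] [Module K R]

instance : SMul K (MInfty R) where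
  smul c A := ⟨fun i j => c • A.entry i j, by
    obtain ⟨M, hM⟩ := A.exists_bound
    exact finite_of_bound (f := fun i j => c • A.entry i j) M fun i j h => by rw [hM i j h, smul_zero]⟩

@[simp] theorem smul_entry (c : K) (A : MInfty R) (i j : ℕ) :
    (c • A).entry i j = c • A.entry i j := rfl

noncomputable instance : Module K (MInfty R) where
  one_smul A := by ext i j; exact one_smul _ _
  mul_smul c d A := by ext i j; exact mul_smul _ _ _
  smul_zero c := by ext i j; exact smul_zero _
  smul_add c A B := by ext i j; exact smul_add _ _ _
  add_smul c d A := by ext i j; exact add_smul _ _ _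
  zero_smul A := by ext i j; exact zero_smul _ _

instance [IsScalarTower K R R] : IsScalarTower K (MInfty R) (MInfty R) where
  smul_assoc c A B := by
    ext i k
    obtain ⟨N, hN⟩ := B.exists_bound
    simp only [smul_eq_mul, smul_entry, mul_entry_right _ hN, Finset.smul_sum, smul_mul_assoc]

instance [SMulCommClass K R R] : SMulCommClass K (MInfty R) (MInfty R) where
  smul_comm c A B := by
    ext i k
    obtain ⟨N, hN⟩ := A.exists_bound
    simp only [smul_eq_mul, smul_entry, mul_entry_left hN, Finset.smul_sum, mul_smul_comm]

end Module

section Star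

variable {R : Type*} [NonUnitalRing R] [StarRing R]

/-- The involution of `M_∞(R)` is the conjugate transpose. -/
instance : Star (MInfty R) where
  star A := ⟨fun i j => star (A.entry j i), by
    obtain ⟨M, hM⟩ := A.exists_bound
    exact finite_of_bound (f := fun i j => star (A.entry j i)) M fun i j h => by rw [hM j i h.symm, star_zero]⟩

@[simp] theorem star_entry (A : MInfty R) (i j : ℕ) : (star A).entry i j = star (A.entry j i) := rfl

noncomputable instance : StarRing (MInfty R) where
  star_involutive A := by ext i j; exact star_star _
  star_add A B := by ext i j; exact star_add _ _
  star_mul A B := by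
    ext i k
    obtain ⟨N, hN⟩ := A.exists_bound
    have hN' : ∀ i j, N ≤ i ∨ N ≤ j → (star A).entry i j = 0 := fun i j h => by
      rw [star_entry, hN j i h.symm, star_zero]
    simp only [star_entry, mul_entry_left hN, mul_entry_right _ hN', star_sum, star_mul]

instance {K : Type*} [Semiring K] [Star K] [Module K R] [StarModule K R] :
    StarModule K (MInfty R) where
  star_smul c A := by ext i j; exact star_smul _ _

end Star

end MInfty

/-! For n ≥ 1 the head vertex (x, n) emits exactly one edge, so the Cuntz–Krieger relation there has
a single summand. Hence the path from (x, n) down to (x, 0) and its ghost path are mutually inverse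
between the two vertices: `headGhost * headPath` is the vertex (x, 0), and `headPath * headGhost` is
the vertex (x, n). No edges are added at level 0, so level 0 carries a copy of the algebra of E. The
algebra of SE therefore looks like the algebra of E with matrix units adjoined: a path down one
head, times a from level 0, times a ghost path up another head, corresponds to a ⊗ e_{mn}.

All three isomorphisms come from one construction. A family of linear maps τ m n that multiplies
like a ↦ a ⊗ e_{mn} (`IsMatrixSystem`) determines a homomorphism `stabHom` on the algebra of SE. Its
range contains every τ m n a (`mem_range_stabHom`). It is injective as soon as τ 0 0 is
(`stabHom_injective`): compressing an element of the kernel by head paths lands in the copy of the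
algebra of E (`headGhost_mul_mul_headPath_mem`), where the homomorphism is τ 0 0, and local units
made of vertices recover the element. With τ m n a the matrix with the single entry a, this gives
the two algebraic statements.

For graph C*-algebras the same argument passes to closures, because injective *-homomorphisms are
isometric and so have closed range (`exists_injective_hom_of_isMatrixSystem`). Here τ m n a is the
class of a ⊗ e_{mn} in a completion of the algebraic tensor product, with e_{mn} the rank-one
operators of a Hilbert basis. They span a dense subspace of the compact operators, which gives
surjectivity. Injectivity of τ 0 0 requires the seminorm not to vanish on nonzero a ⊗ e_{00}. For
the maximal seminorm this follows from one explicit seminorm, the limit along an ultrafilter of the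
norms of the N × N compressions (`HilbertBasis.exists_mem_tensorSeminorms`). -/

namespace DirectedGraph

/-! ### Edges and regular vertices of the stabilization. -/

variable {E : DirectedGraph.{u, v}}

/-- The vertex `(x, n)` of the stabilization. -/
def stabVertex (x : E.Vertex) (n : ℕ) : E.stabilization.Vertex := (x, n)

/-- An edge of `E` as an edge of the stabilization. -/
def baseEdge (e : E.Edge) : E.stabilization.Edge := Sum.inl e

/-- The edge from `(x, n + 1)` to `(x, n)` of the stabilization. -/
def headEdge (x : E.Vertex) (n : ℕ) : E.stabilization.Edge := Sum.inr (x, n)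

theorem stabVertex_inj {x y : E.Vertex} {m n : ℕ} :
    stabVertex x m = stabVertex y n ↔ x = y ∧ m = n := Prod.mk_inj

theorem baseEdge_injective : Function.Injective (baseEdge (E := E)) := Sum.inl_injective

theorem headEdge_inj {x y : E.Vertex} {m n : ℕ} :
    headEdge x m = headEdge y n ↔ x = y ∧ m = n := Sum.inr_injective.eq_iff.trans Prod.mk_inj

theorem baseEdge_ne_headEdge (e : E.Edge) (x : E.Vertex) (n : ℕ) : baseEdge e ≠ headEdge x n :=
  Sum.inl_ne_inr

theorem exists_eq_stabVertex (p : E.stabilization.Vertex) : ∃ x n, p = stabVertex x n :=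
  ⟨p.1, p.2, rfl⟩

theorem stabilization_edge_cases (e : E.stabilization.Edge) :
    (∃ f, e = baseEdge f) ∨ ∃ x n, e = headEdge x n := by
  rcases e with f | ⟨x, n⟩
  exacts [.inl ⟨f, rfl⟩, .inr ⟨x, n, rfl⟩]

theorem source_baseEdge (e : E.Edge) :
    E.stabilization.source (baseEdge e) = stabVertex (E.source e) 0 := rfl

theorem range_baseEdge (e : E.Edge) :
    E.stabilization.range (baseEdge e) = stabVertex (E.range e) 0 := rfl

theorem source_headEdge (x : E.Vertex) (n : ℕ) :
    E.stabilization.source (headEdge x n) = stabVertex x (n + 1) := rfl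

theorem range_headEdge (x : E.Vertex) (n : ℕ) :
    E.stabilization.range (headEdge x n) = stabVertex x n := rfl

theorem source_eq_stabVertex_succ_iff (x : E.Vertex) (n : ℕ) (e : E.stabilization.Edge) :
    E.stabilization.source e = stabVertex x (n + 1) ↔ e = headEdge x n := by
  rcases stabilization_edge_cases e with ⟨f, rfl⟩ | ⟨y, m, rfl⟩
  · rw [source_baseEdge, stabVertex_inj]
    exact iff_of_false (by omega) (baseEdge_ne_headEdge f x n)
  · rw [source_headEdge, stabVertex_inj, headEdge_inj, Nat.add_right_cancel_iff]

/-- Head edges start at positive levels only, so attaching a head does not change the edges emitted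
at level 0. Hence no Cuntz–Krieger relation is gained or lost there. -/
theorem source_eq_stabVertex_zero_iff (x : E.Vertex) (e : E.stabilization.Edge) :
    E.stabilization.source e = stabVertex x 0 ↔ ∃ f, E.source f = x ∧ baseEdge f = e := by
  rcases stabilization_edge_cases e with ⟨f, rfl⟩ | ⟨y, m, rfl⟩
  · rw [source_baseEdge, stabVertex_inj]
    simp [baseEdge_injective.eq_iff]
  · rw [source_headEdge, stabVertex_inj]
    exact iff_of_false (by omega) fun ⟨f, _, hf⟩ => baseEdge_ne_headEdge f y m hf

/-- The head edge is the only one that starts here; the resulting one-term relation is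
`edge_headEdge_mul_ghost`. -/
theorem isRegular_stabVertex_succ (x : E.Vertex) (n : ℕ) :
    E.stabilization.IsRegular (stabVertex x (n + 1)) := by
  have : {e | E.stabilization.source e = stabVertex x (n + 1)} = {headEdge x n} :=
    Set.ext (source_eq_stabVertex_succ_iff x n)
  rw [IsRegular, this]
  exact ⟨Set.singleton_nonempty _, Set.finite_singleton _⟩

theorem isRegular_stabVertex_zero_iff (x : E.Vertex) :
    E.stabilization.IsRegular (stabVertex x 0) ↔ E.IsRegular x := by
  have : {e | E.stabilization.source e = stabVertex x 0} = baseEdge '' {e | E.source e = x} :=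
    Set.ext (source_eq_stabVertex_zero_iff x)
  rw [IsRegular, this, Set.image_nonempty, Set.finite_image_iff baseEdge_injective.injOn, IsRegular]

theorem sum_source_eq_stabVertex_succ {M : Type*} [AddCommMonoid M] (x : E.Vertex) (n : ℕ)
    (h : E.stabilization.IsRegular (stabVertex x (n + 1))) (f : E.stabilization.Edge → M) :
    ∑ e ∈ h.2.toFinset, f e = f (headEdge x n) := by
  have : h.2.toFinset = {headEdge x n} := by
    ext e
    rw [Set.Finite.mem_toFinset, Finset.mem_singleton]
    exact source_eq_stabVertex_succ_iff x n e
  rw [this, Finset.sum_singleton]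

theorem sum_source_eq_stabVertex_zero {M : Type*} [AddCommMonoid M] (x : E.Vertex)
    (h : E.stabilization.IsRegular (stabVertex x 0)) (h' : E.IsRegular x)
    (f : E.stabilization.Edge → M) :
    ∑ e ∈ h.2.toFinset, f e = ∑ e ∈ h'.2.toFinset, f (baseEdge e) := by
  have : h.2.toFinset = h'.2.toFinset.map ⟨baseEdge, baseEdge_injective⟩ := by
    ext e
    rw [Set.Finite.mem_toFinset, Finset.mem_map]
    simpa using source_eq_stabVertex_zero_iff x e
  rw [this, Finset.sum_map]
  rfl

end DirectedGraph

/-! ### Relations, local units and homomorphisms of Leavitt path algebras. -/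

namespace LeavittPathAlgebra

section Relations

variable (K : Type w) [Field K] {E : DirectedGraph.{u, v}}

theorem vertex_mul_self (x : E.Vertex) : vertex K x * vertex K x = vertex K x :=
  mk_rel K (.vertex_idem x)

theorem vertex_mul_vertex_of_ne {x y : E.Vertex} (h : x ≠ y) : vertex K x * vertex K y = 0 :=
  mk_rel K (.vertex_orth x y h)

theorem source_mul_edge (e : E.Edge) : vertex K (E.source e) * edge K e = edge K e :=
  mk_rel K (.source_edge e)

theorem edge_mul_range (e : E.Edge) : edge K e * vertex K (E.range e) = edge K e :=
  mk_rel K (.edge_range e)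

theorem range_mul_ghost (e : E.Edge) : vertex K (E.range e) * ghost K e = ghost K e :=
  mk_rel K (.range_ghost e)

theorem ghost_mul_source (e : E.Edge) : ghost K e * vertex K (E.source e) = ghost K e :=
  mk_rel K (.ghost_source e)

theorem ghost_mul_edge (e : E.Edge) : ghost K e * edge K e = vertex K (E.range e) :=
  mk_rel K (.ghost_edge e)

theorem ghost_mul_edge_of_ne {e f : E.Edge} (h : e ≠ f) : ghost K e * edge K f = 0 :=
  mk_rel K (.ghost_edge_orth e f h)

theorem vertex_eq_sum (x : E.Vertex) (h : E.IsRegular x) :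
    vertex K x = ∑ e ∈ h.2.toFinset, edge K e * ghost K e :=
  (mk_rel K (.sum_edge_ghost x h)).trans (map_sum (mkAddHom K) _ _)

theorem vertex_mul_vertex [DecidableEq E.Vertex] (x y : E.Vertex) :
    vertex K x * vertex K y = if x = y then vertex K x else 0 := by
  split_ifs with h
  · rw [← h, vertex_mul_self]
  · exact vertex_mul_vertex_of_ne K h

/-- Every element of a Leavitt path algebra has a left local unit which is a finite sum of
vertices. -/
theorem exists_sum_vertex_mul (w : LeavittPathAlgebra K E) :
    ∃ F : Finset E.Vertex, ∑ x ∈ F, vertex K x * w = w := by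
  classical
  have key : ∀ (x : E.Vertex) (w : LeavittPathAlgebra K E), vertex K x * w = w →
      ∃ F : Finset E.Vertex, ∑ x ∈ F, vertex K x * w = w :=
    fun x w h => ⟨{x}, by rw [Finset.sum_singleton, h]⟩
  induction w using LeavittPathAlgebra.induction with
  | hv x => exact key x _ (vertex_mul_self K x)
  | he e => exact key _ _ (source_mul_edge K e)
  | hg e => exact key _ _ (range_mul_ghost K e)
  | h0 => exact ⟨∅, rfl⟩
  | hadd a b ha hb =>
    -- A local unit remains one when vertices are added, as (∑_G p)(∑_F p) = ∑_F p by orthogonality.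
    -- So F ∪ G serves both summands.
    have mono : ∀ (F G : Finset E.Vertex) (w : LeavittPathAlgebra K E), F ⊆ G →
        ∑ x ∈ F, vertex K x * w = w → ∑ x ∈ G, vertex K x * w = w := by
      intro F G w hFG h
      rw [← Finset.sum_mul] at h ⊢
      conv_lhs => rw [← h]
      rw [← mul_assoc, Finset.sum_mul_sum]
      simp only [vertex_mul_vertex, Finset.sum_ite_eq]
      rw [← Finset.sum_filter, Finset.filter_mem_eq_inter, Finset.inter_eq_right.2 hFG, h]
    obtain ⟨F, hF⟩ := ha
    obtain ⟨G, hG⟩ := hb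
    refine ⟨F ∪ G, ?_⟩
    simp only [mul_add, Finset.sum_add_distrib]
    rw [mono F _ a Finset.subset_union_left hF, mono G _ b Finset.subset_union_right hG]
  | hmul a b ha hb =>
    obtain ⟨F, hF⟩ := ha
    refine ⟨F, ?_⟩
    simp only [← mul_assoc]
    rw [← Finset.sum_mul, hF]
  | hsmul c a ha =>
    obtain ⟨F, hF⟩ := ha
    refine ⟨F, ?_⟩
    simp only [mul_smul_comm]
    rw [← Finset.smul_sum, hF]

/-- Every element of a Leavitt path algebra has a right local unit which is a finite sum of
vertices. -/
theorem exists_sum_mul_vertex (w : LeavittPathAlgebra K E) :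
    ∃ F : Finset E.Vertex, ∑ x ∈ F, w * vertex K x = w := by
  classical
  have key : ∀ (x : E.Vertex) (w : LeavittPathAlgebra K E), w * vertex K x = w →
      ∃ F : Finset E.Vertex, ∑ x ∈ F, w * vertex K x = w :=
    fun x w h => ⟨{x}, by rw [Finset.sum_singleton, h]⟩
  induction w using LeavittPathAlgebra.induction with
  | hv x => exact key x _ (vertex_mul_self K x)
  | he e => exact key _ _ (edge_mul_range K e)
  | hg e => exact key _ _ (ghost_mul_source K e)
  | h0 => exact ⟨∅, rfl⟩
  | hadd a b ha hb =>
    have mono : ∀ (F G : Finset E.Vertex) (w : LeavittPathAlgebra K E), F ⊆ G →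
        ∑ x ∈ F, w * vertex K x = w → ∑ x ∈ G, w * vertex K x = w := by
      intro F G w hFG h
      rw [← Finset.mul_sum] at h ⊢
      conv_lhs => rw [← h]
      rw [mul_assoc, Finset.sum_mul_sum, Finset.sum_comm]
      simp only [vertex_mul_vertex, Finset.sum_ite_eq']
      rw [← Finset.sum_filter, Finset.filter_mem_eq_inter, Finset.inter_eq_right.2 hFG, h]
    obtain ⟨F, hF⟩ := ha
    obtain ⟨G, hG⟩ := hb
    refine ⟨F ∪ G, ?_⟩
    simp only [add_mul, Finset.sum_add_distrib]
    rw [mono F _ a Finset.subset_union_left hF, mono G _ b Finset.subset_union_right hG]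
  | hmul a b ha hb =>
    obtain ⟨F, hF⟩ := hb
    refine ⟨F, ?_⟩
    simp only [mul_assoc]
    rw [← Finset.mul_sum, hF]
  | hsmul c a ha =>
    obtain ⟨F, hF⟩ := ha
    refine ⟨F, ?_⟩
    simp only [smul_mul_assoc]
    rw [← Finset.smul_sum, hF]

end Relations

/-- A family of elements that satisfies the defining relations of the Leavitt path algebra
determines a homomorphism on the Leavitt path algebra. -/
theorem exists_hom {K : Type w} [Field K] {E : DirectedGraph.{u, v}} {A : Type*}
    [NonUnitalRing A] [Module K A] [IsScalarTower K A A] [SMulCommClass K A A]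
    (V : E.Vertex → A) (S T : E.Edge → A) (hV : ∀ x, V x * V x = V x)
    (hV' : ∀ x y, x ≠ y → V x * V y = 0) (hVS : ∀ e, V (E.source e) * S e = S e)
    (hSV : ∀ e, S e * V (E.range e) = S e) (hVT : ∀ e, V (E.range e) * T e = T e)
    (hTV : ∀ e, T e * V (E.source e) = T e) (hTS : ∀ e, T e * S e = V (E.range e))
    (hTS' : ∀ e f, e ≠ f → T e * S f = 0)
    (hsum : ∀ x (h : E.IsRegular x), V x = ∑ e ∈ h.2.toFinset, S e * T e) :
    ∃ φ : LeavittPathAlgebra K E →ₙₐ[K] A, (∀ x, φ (vertex K x) = V x) ∧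
      (∀ e, φ (edge K e) = S e) ∧ ∀ e, φ (ghost K e) = T e := by
  have hgen : ∀ (f : LeavittGenerator E → A) g, MonoidAlgebra.liftMagma K
      (FreeSemigroup.lift f) (LeavittFree.gen K g) = f g := fun f g => by
    simp [LeavittFree.gen, MonoidAlgebra.liftMagma]
  obtain ⟨φ, hφ⟩ := exists_lift (K := K) (E := E) (A := A)
    (fun | .vertex x => V x | .edge e => S e | .ghost e => T e) (by
      intro a b hab
      cases hab <;>
        simp only [map_mul, map_zero, map_sum, LeavittFree.vertex, LeavittFree.edge,
          LeavittFree.ghost, hgen]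
      · exact hV _
      · exact hV' _ _ ‹_›
      · exact hVS _
      · exact hSV _
      · exact hVT _
      · exact hTV _
      · exact hTS _
      · exact hTS' _ _ ‹_›
      · exact hsum _ ‹_›)
  exact ⟨φ, fun x => (hφ _).trans (hgen _ _), fun e => (hφ _).trans (hgen _ _),
    fun e => (hφ _).trans (hgen _ _)⟩

/-- Two homomorphisms on a Leavitt path algebra which agree on the generators are equal. -/
theorem hom_ext {K : Type w} [Field K] {E : DirectedGraph.{u, v}} {A : Type*}
    [NonUnitalRing A] [Module K A] {φ ψ : LeavittPathAlgebra K E →ₙₐ[K] A}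
    (hV : ∀ x, φ (vertex K x) = ψ (vertex K x)) (hE : ∀ e, φ (edge K e) = ψ (edge K e))
    (hG : ∀ e, φ (ghost K e) = ψ (ghost K e)) (z : LeavittPathAlgebra K E) : φ z = ψ z := by
  induction z using LeavittPathAlgebra.induction with
  | hv x => exact hV x
  | he e => exact hE e
  | hg e => exact hG e
  | h0 => rw [map_zero, map_zero]
  | hadd x y hx hy => rw [map_add, map_add, hx, hy]
  | hmul x y hx hy => rw [map_mul, map_mul, hx, hy]
  | hsmul c x hx => rw [map_smul, map_smul, hx]

end LeavittPathAlgebra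

namespace LeavittPathAlgebra

open DirectedGraph

/-! ### The inclusion of the graph into its stabilization and paths in the heads -/

section HeadPath

variable (K : Type w) [Field K] {E : DirectedGraph.{u, v}}

/-- Level 0 of the stabilization has the same edges out of each vertex as E, so every defining
relation of E, including the sum relation at regular vertices, holds there. -/
theorem exists_baseHom (E : DirectedGraph.{u, v}) :
    ∃ φ : LeavittPathAlgebra K E →ₙₐ[K] LeavittPathAlgebra K E.stabilization,
      (∀ x, φ (vertex K x) = vertex K (stabVertex x 0)) ∧
      (∀ e, φ (edge K e) = edge K (baseEdge e)) ∧ ∀ e, φ (ghost K e) = ghost K (baseEdge e) := by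
  refine exists_hom _ _ _ (fun x => vertex_mul_self K _) (fun x y h => vertex_mul_vertex_of_ne K ?_)
    (fun e => source_mul_edge K (baseEdge e)) (fun e => edge_mul_range K (baseEdge e))
    (fun e => range_mul_ghost K (baseEdge e)) (fun e => ghost_mul_source K (baseEdge e))
    (fun e => ghost_mul_edge K (baseEdge e))
    (fun e f h => ghost_mul_edge_of_ne K (baseEdge_injective.ne h)) fun x h => ?_
  · rw [Ne, stabVertex_inj]
    exact fun h' => h h'.1
  · have h' := (isRegular_stabVertex_zero_iff x).2 h
    rw [vertex_eq_sum K _ h', sum_source_eq_stabVertex_zero x h' h]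

/-- The homomorphism of Leavitt path algebras given by the inclusion of a graph into its
stabilization. -/
noncomputable def baseHom (E : DirectedGraph.{u, v}) :
    LeavittPathAlgebra K E →ₙₐ[K] LeavittPathAlgebra K E.stabilization :=
  (exists_baseHom K E).choose

theorem baseHom_vertex (x : E.Vertex) : baseHom K E (vertex K x) = vertex K (stabVertex x 0) :=
  (exists_baseHom K E).choose_spec.1 x

theorem baseHom_edge (e : E.Edge) : baseHom K E (edge K e) = edge K (baseEdge e) :=
  (exists_baseHom K E).choose_spec.2.1 e

theorem baseHom_ghost (e : E.Edge) : baseHom K E (ghost K e) = ghost K (baseEdge e) :=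
  (exists_baseHom K E).choose_spec.2.2 e

/-- The path from `(x, n)` to `(x, 0)` in the head at `x`. -/
noncomputable def headPath (x : E.Vertex) : ℕ → LeavittPathAlgebra K E.stabilization
  | 0 => vertex K (stabVertex x 0)
  | n + 1 => edge K (headEdge x n) * headPath x n

/-- The ghost path that belongs to the path from `(x, n)` to `(x, 0)` in the head at `x`. -/
noncomputable def headGhost (x : E.Vertex) : ℕ → LeavittPathAlgebra K E.stabilization
  | 0 => vertex K (stabVertex x 0)
  | n + 1 => headGhost x n * ghost K (headEdge x n)

variable (x y : E.Vertex) (m n : ℕ)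

theorem vertex_mul_headPath : vertex K (stabVertex x n) * headPath K x n = headPath K x n := by
  cases n with
  | zero => exact vertex_mul_self K _
  | succ n => rw [headPath, ← mul_assoc, ← source_headEdge, source_mul_edge]

theorem headGhost_mul_vertex : headGhost K x n * vertex K (stabVertex x n) = headGhost K x n := by
  cases n with
  | zero => exact vertex_mul_self K _
  | succ n => rw [headGhost, mul_assoc, ← source_headEdge, ghost_mul_source]

theorem headGhost_mul_headPath_self :
    headGhost K x n * headPath K x n = vertex K (stabVertex x 0) := by
  induction n with
  | zero => exact vertex_mul_self K _
  | succ n ih =>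
    rw [headPath, headGhost, mul_assoc, ← mul_assoc (ghost K _), ghost_mul_edge, range_headEdge,
      vertex_mul_headPath, ih]

theorem edge_headEdge_mul_ghost :
    edge K (headEdge x n) * ghost K (headEdge x n) = vertex K (stabVertex x (n + 1)) := by
  have h := isRegular_stabVertex_succ x n
  rw [vertex_eq_sum K _ h, sum_source_eq_stabVertex_succ x n h]

/-- The vertex in the middle is absorbed and one factor `edge * ghost` is left, which is a vertex by
the one-term relation. For paths in a general graph only the opposite order gives a vertex; this
equality is what is special about heads. -/
theorem headPath_mul_headGhost_self :
    headPath K x n * headGhost K x n = vertex K (stabVertex x n) := by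
  induction n with
  | zero => exact vertex_mul_self K _
  | succ n ih =>
    rw [headPath, headGhost, mul_assoc, ← mul_assoc (headPath K x n), ih, ← range_headEdge,
      range_mul_ghost, edge_headEdge_mul_ghost]

variable {x y m n} in
theorem headGhost_mul_vertex_of_ne {p : E.stabilization.Vertex} (h : stabVertex x m ≠ p) :
    headGhost K x m * vertex K p = 0 := by
  rw [← headGhost_mul_vertex, mul_assoc, vertex_mul_vertex_of_ne K h, mul_zero]

/-- Paths that start at different vertices are orthogonal, and equal ones multiply to a vertex of
level 0. -/
theorem headGhost_mul_headPath_mem : headGhost K x m * headPath K y n ∈ Set.range (baseHom K E) := by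
  by_cases h : stabVertex x m = stabVertex y n
  · obtain ⟨rfl, rfl⟩ := stabVertex_inj.1 h
    exact ⟨vertex K x, by rw [baseHom_vertex, headGhost_mul_headPath_self]⟩
  · exact ⟨0, by rw [map_zero, ← vertex_mul_headPath, ← mul_assoc, headGhost_mul_vertex_of_ne K h,
      zero_mul]⟩

/-- Puts the generator into the form path times ghost path, which can be compressed by means of
`headGhost_mul_headPath_mem`. -/
theorem edge_headEdge_eq : edge K (headEdge x n) = headPath K x (n + 1) * headGhost K x n := by
  rw [headPath, mul_assoc, headPath_mul_headGhost_self, ← range_headEdge, edge_mul_range]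

theorem ghost_headEdge_eq : ghost K (headEdge x n) = headPath K x n * headGhost K x (n + 1) := by
  rw [headGhost, ← mul_assoc, headPath_mul_headGhost_self, ← range_headEdge, range_mul_ghost]

-- Each generator factors as `headPath * c * headGhost` with c from level 0 or absent, so
-- sandwiching it leaves a product of elements handled by `headGhost_mul_headPath_mem` and of c.
-- This is the step that reduces injectivity on the stabilization to injectivity on the corner.
variable {K} in
theorem headGhost_mul_mul_headPath_mem (z : LeavittPathAlgebra K E.stabilization) :
    headGhost K x m * z * headPath K y n ∈ Set.range (baseHom K E) := by
  have mul_mem : ∀ {a b}, a ∈ Set.range (baseHom K E) → b ∈ Set.range (baseHom K E) →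
      a * b ∈ Set.range (baseHom K E) := by
    rintro _ _ ⟨a, rfl⟩ ⟨b, rfl⟩
    exact ⟨a * b, map_mul _ _ _⟩
  have sum_mem : ∀ {ι : Type _} (F : Finset ι) (f : ι → LeavittPathAlgebra K E.stabilization),
      (∀ i, f i ∈ Set.range (baseHom K E)) → ∑ i ∈ F, f i ∈ Set.range (baseHom K E) := by
    intro ι F f h
    choose a ha using h
    exact ⟨∑ i ∈ F, a i, by simp only [map_sum, ha]⟩
  induction z using LeavittPathAlgebra.induction generalizing x y m n with
  | hv p =>
    obtain ⟨u, k, rfl⟩ := exists_eq_stabVertex p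
    rw [← headPath_mul_headGhost_self, ← mul_assoc, mul_assoc _ (headGhost K u k)]
    exact mul_mem (headGhost_mul_headPath_mem K x u m k) (headGhost_mul_headPath_mem K u y k n)
  | he e =>
    rcases stabilization_edge_cases e with ⟨f, rfl⟩ | ⟨u, k, rfl⟩
    · have h : edge K (baseEdge f) = headPath K (E.source f) 0 *
          (baseHom K E (edge K f) * headGhost K (E.range f) 0) := by
        rw [headPath, headGhost, baseHom_edge, ← range_baseEdge, edge_mul_range, ← source_baseEdge,
          source_mul_edge]
      rw [h, ← mul_assoc, ← mul_assoc, mul_assoc _ (headGhost K _ _)]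
      exact mul_mem (mul_mem (headGhost_mul_headPath_mem K _ _ _ _) ⟨_, rfl⟩)
        (headGhost_mul_headPath_mem K _ _ _ _)
    · rw [edge_headEdge_eq, ← mul_assoc, mul_assoc _ (headGhost K u k)]
      exact mul_mem (headGhost_mul_headPath_mem K _ _ _ _) (headGhost_mul_headPath_mem K _ _ _ _)
  | hg e =>
    rcases stabilization_edge_cases e with ⟨f, rfl⟩ | ⟨u, k, rfl⟩
    · have h : ghost K (baseEdge f) = headPath K (E.range f) 0 *
          (baseHom K E (ghost K f) * headGhost K (E.source f) 0) := by
        rw [headPath, headGhost, baseHom_ghost, ← source_baseEdge, ghost_mul_source,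
          ← range_baseEdge, range_mul_ghost]
      rw [h, ← mul_assoc, ← mul_assoc, mul_assoc _ (headGhost K _ _)]
      exact mul_mem (mul_mem (headGhost_mul_headPath_mem K _ _ _ _) ⟨_, rfl⟩)
        (headGhost_mul_headPath_mem K _ _ _ _)
    · rw [ghost_headEdge_eq, ← mul_assoc, mul_assoc _ (headGhost K u _)]
      exact mul_mem (headGhost_mul_headPath_mem K _ _ _ _) (headGhost_mul_headPath_mem K _ _ _ _)
  | h0 => exact ⟨0, by rw [mul_zero, zero_mul, map_zero]⟩
  | hadd a b ha hb =>
    obtain ⟨a', ha'⟩ := ha x y m n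
    obtain ⟨b', hb'⟩ := hb x y m n
    exact ⟨a' + b', by rw [map_add, ha', hb', mul_add, add_mul]⟩
  | hmul a b ha hb =>
    -- A local unit of b is inserted between a and b. Each of its vertices is `headPath *
    -- headGhost`, so every summand splits into a compression of a times a compression of b, with
    -- new indices in the middle.
    obtain ⟨F, hF⟩ := exists_sum_vertex_mul K b
    rw [← hF, Finset.mul_sum, Finset.mul_sum, Finset.sum_mul]
    refine sum_mem F _ fun p => ?_
    obtain ⟨u, k, rfl⟩ := exists_eq_stabVertex p
    have h : headGhost K x m * (a * (vertex K (stabVertex u k) * b)) * headPath K y n =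
        (headGhost K x m * a * headPath K u k) * (headGhost K u k * b * headPath K y n) := by
      rw [← headPath_mul_headGhost_self]
      simp only [mul_assoc]
    rw [h]
    exact mul_mem (ha x u m k) (hb u y k n)
  | hsmul c a ha =>
    obtain ⟨a', ha'⟩ := ha x y m n
    exact ⟨c • a', by rw [map_smul, ha', mul_smul_comm, smul_mul_assoc]⟩

end HeadPath

/-! ### Homomorphisms given by systems of matrix units -/

/-- A system of linear maps that multiplies like the maps `a ↦ a ⊗ e_{mn}`, where `e_{mn}` are
matrix units. -/
structure IsMatrixSystem {K A R : Type*} [Semiring K] [NonUnitalRing A] [Module K A]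
    [NonUnitalRing R] [Module K R] (τ : ℕ → ℕ → A →ₗ[K] R) : Prop where
  mul_same : ∀ l m n a b, τ l m a * τ m n b = τ l n (a * b)
  mul_of_ne : ∀ k l m n a b, l ≠ m → τ k l a * τ m n b = 0

namespace IsMatrixSystem

variable {K : Type w} [Field K] {E : DirectedGraph.{u, v}} {R : Type*} [NonUnitalRing R]
  [Module K R] [IsScalarTower K R R] [SMulCommClass K R R]
  {τ : ℕ → ℕ → LeavittPathAlgebra K E →ₗ[K] R}

/-- The row index records the level of the source and the column index that of the range, so a head
edge goes to τ (n + 1) n. The sum relation at (x, n + 1) is then `mul_same` applied to one product,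
and the one at (x, 0) is the image under τ 0 0 of the relation of E at x. -/
theorem exists_stabHom (h : IsMatrixSystem τ) : ∃ φ : LeavittPathAlgebra K E.stabilization →ₙₐ[K] R,
    (∀ x n, φ (vertex K (stabVertex x n)) = τ n n (vertex K x)) ∧
    (∀ e, φ (edge K (baseEdge e)) = τ 0 0 (edge K e)) ∧
    (∀ e, φ (ghost K (baseEdge e)) = τ 0 0 (ghost K e)) ∧
    (∀ x n, φ (edge K (headEdge x n)) = τ (n + 1) n (vertex K x)) ∧
    (∀ x n, φ (ghost K (headEdge x n)) = τ n (n + 1) (vertex K x)) := by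
  let V : E.stabilization.Vertex → R := fun p => τ p.2 p.2 (vertex K p.1)
  let S : E.stabilization.Edge → R :=
    Sum.elim (fun e => τ 0 0 (edge K e)) fun p => τ (p.2 + 1) p.2 (vertex K p.1)
  let T : E.stabilization.Edge → R :=
    Sum.elim (fun e => τ 0 0 (ghost K e)) fun p => τ p.2 (p.2 + 1) (vertex K p.1)
  have hV : ∀ x n, V (stabVertex x n) = τ n n (vertex K x) := fun _ _ => rfl
  have hS : ∀ e, S (baseEdge e) = τ 0 0 (edge K e) := fun _ => rfl
  have hS' : ∀ x n, S (headEdge x n) = τ (n + 1) n (vertex K x) := fun _ _ => rfl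
  have hT : ∀ e, T (baseEdge e) = τ 0 0 (ghost K e) := fun _ => rfl
  have hT' : ∀ x n, T (headEdge x n) = τ n (n + 1) (vertex K x) := fun _ _ => rfl
  refine (exists_hom (K := K) V S T ?_ ?_ ?_ ?_ ?_ ?_ ?_ ?_ ?_).imp fun φ ⟨hφV, hφS, hφT⟩ =>
    ⟨fun x n => hφV _, fun e => hφS _, fun e => hφT _, fun x n => hφS _, fun x n => hφT _⟩
  · intro p
    obtain ⟨x, n, rfl⟩ := exists_eq_stabVertex p
    rw [hV, h.mul_same, vertex_mul_self]
  · intro p q hpq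
    obtain ⟨x, n, rfl⟩ := exists_eq_stabVertex p
    obtain ⟨y, m, rfl⟩ := exists_eq_stabVertex q
    rw [hV, hV]
    by_cases hnm : n = m
    · subst hnm
      rw [h.mul_same, vertex_mul_vertex_of_ne, map_zero]
      rintro rfl
      exact hpq rfl
    · exact h.mul_of_ne _ _ _ _ _ _ hnm
  · intro e
    rcases stabilization_edge_cases e with ⟨f, rfl⟩ | ⟨y, m, rfl⟩
    · rw [source_baseEdge, hV, hS, h.mul_same, source_mul_edge]
    · rw [source_headEdge, hV, hS', h.mul_same, vertex_mul_self]
  · intro e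
    rcases stabilization_edge_cases e with ⟨f, rfl⟩ | ⟨y, m, rfl⟩
    · rw [range_baseEdge, hV, hS, h.mul_same, edge_mul_range]
    · rw [range_headEdge, hV, hS', h.mul_same, vertex_mul_self]
  · intro e
    rcases stabilization_edge_cases e with ⟨f, rfl⟩ | ⟨y, m, rfl⟩
    · rw [range_baseEdge, hV, hT, h.mul_same, range_mul_ghost]
    · rw [range_headEdge, hV, hT', h.mul_same, vertex_mul_self]
  · intro e
    rcases stabilization_edge_cases e with ⟨f, rfl⟩ | ⟨y, m, rfl⟩
    · rw [source_baseEdge, hV, hT, h.mul_same, ghost_mul_source]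
    · rw [source_headEdge, hV, hT', h.mul_same, vertex_mul_self]
  · intro e
    rcases stabilization_edge_cases e with ⟨f, rfl⟩ | ⟨y, m, rfl⟩
    · rw [range_baseEdge, hV, hT, hS, h.mul_same, ghost_mul_edge]
    · rw [range_headEdge, hV, hT', hS', h.mul_same, vertex_mul_self]
  · intro e e' hee
    rcases stabilization_edge_cases e with ⟨f, rfl⟩ | ⟨y, m, rfl⟩ <;>
      rcases stabilization_edge_cases e' with ⟨f', rfl⟩ | ⟨y', m', rfl⟩
    · rw [hT, hS, h.mul_same, ghost_mul_edge_of_ne, map_zero]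
      rintro rfl
      exact hee rfl
    -- The inner indices are 0 and `m' + 1`: a head edge never starts at level 0.
    · rw [hT, hS', h.mul_of_ne _ _ _ _ _ _ (by omega)]
    · rw [hT', hS, h.mul_of_ne _ _ _ _ _ _ (by omega)]
    · rw [hT', hS']
      by_cases hm : m = m'
      · subst hm
        rw [h.mul_same, vertex_mul_vertex_of_ne, map_zero]
        rintro rfl
        exact hee rfl
      · exact h.mul_of_ne _ _ _ _ _ _ (by omega)
  · intro p hp
    obtain ⟨x, n, rfl⟩ := exists_eq_stabVertex p
    cases n with
    | zero =>
      have hx := (isRegular_stabVertex_zero_iff x).1 hp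
      rw [sum_source_eq_stabVertex_zero x hp hx, hV, vertex_eq_sum K x hx, map_sum]
      refine Finset.sum_congr rfl fun e _ => ?_
      rw [hS, hT, h.mul_same]
    | succ n => rw [sum_source_eq_stabVertex_succ x n hp, hV, hS', hT', h.mul_same, vertex_mul_self]

variable (h : IsMatrixSystem τ)

/-- The homomorphism on the Leavitt path algebra of the stabilization that is given by a system of
matrix units. -/
noncomputable def stabHom : LeavittPathAlgebra K E.stabilization →ₙₐ[K] R :=
  h.exists_stabHom.choose

theorem stabHom_vertex (x : E.Vertex) (n : ℕ) :
    h.stabHom (vertex K (stabVertex x n)) = τ n n (vertex K x) :=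
  h.exists_stabHom.choose_spec.1 x n

theorem stabHom_edge_baseEdge (e : E.Edge) :
    h.stabHom (edge K (baseEdge e)) = τ 0 0 (edge K e) :=
  h.exists_stabHom.choose_spec.2.1 e

theorem stabHom_ghost_baseEdge (e : E.Edge) :
    h.stabHom (ghost K (baseEdge e)) = τ 0 0 (ghost K e) :=
  h.exists_stabHom.choose_spec.2.2.1 e

theorem stabHom_edge_headEdge (x : E.Vertex) (n : ℕ) :
    h.stabHom (edge K (headEdge x n)) = τ (n + 1) n (vertex K x) :=
  h.exists_stabHom.choose_spec.2.2.2.1 x n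

theorem stabHom_ghost_headEdge (x : E.Vertex) (n : ℕ) :
    h.stabHom (ghost K (headEdge x n)) = τ n (n + 1) (vertex K x) :=
  h.exists_stabHom.choose_spec.2.2.2.2 x n

theorem stabHom_headPath (x : E.Vertex) (n : ℕ) :
    h.stabHom (headPath K x n) = τ n 0 (vertex K x) := by
  induction n with
  | zero => exact h.stabHom_vertex x 0
  | succ n ih => rw [headPath, map_mul, ih, stabHom_edge_headEdge, h.mul_same, vertex_mul_self]

theorem stabHom_headGhost (x : E.Vertex) (n : ℕ) :
    h.stabHom (headGhost K x n) = τ 0 n (vertex K x) := by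
  induction n with
  | zero => exact h.stabHom_vertex x 0
  | succ n ih => rw [headGhost, map_mul, ih, stabHom_ghost_headEdge, h.mul_same, vertex_mul_self]

/-- The map τ 0 0 is multiplicative, since all indices in `mul_same` can be taken to be 0. So both
sides are homomorphisms in a and generators suffice. -/
theorem stabHom_baseHom (a : LeavittPathAlgebra K E) : h.stabHom (baseHom K E a) = τ 0 0 a := by
  let ψ : LeavittPathAlgebra K E →ₙₐ[K] R :=
    { τ 0 0 with map_mul' := fun a b => (h.mul_same 0 0 0 a b).symm, map_zero' := map_zero (τ 0 0) }
  refine hom_ext (φ := h.stabHom.comp (baseHom K E)) (ψ := ψ) (fun x => ?_) (fun e => ?_)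
    (fun e => ?_) a
  · exact (congrArg h.stabHom (baseHom_vertex K x)).trans (h.stabHom_vertex x 0)
  · exact (congrArg h.stabHom (baseHom_edge K e)).trans (h.stabHom_edge_baseEdge e)
  · exact (congrArg h.stabHom (baseHom_ghost K e)).trans (h.stabHom_ghost_baseEdge e)

/-- For a vertex, the preimage is the path down its head from level m times the ghost path up to
level n. Other elements are factored so that these vertices change the indices around the corner (0,
0). -/
theorem mem_range_stabHom (m n : ℕ) (a : LeavittPathAlgebra K E) :
    τ m n a ∈ Set.range h.stabHom := by
  have hv : ∀ (x : E.Vertex) m n, τ m n (vertex K x) ∈ Set.range h.stabHom := fun x m n =>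
    ⟨headPath K x m * headGhost K x n, by
      rw [map_mul, stabHom_headPath, stabHom_headGhost, h.mul_same, vertex_mul_self]⟩
  have mul_mem : ∀ {a b}, a ∈ Set.range h.stabHom → b ∈ Set.range h.stabHom →
      a * b ∈ Set.range h.stabHom := by
    rintro _ _ ⟨a, rfl⟩ ⟨b, rfl⟩
    exact ⟨a * b, map_mul _ _ _⟩
  induction a using LeavittPathAlgebra.induction generalizing m n with
  | hv x => exact hv x m n
  | he e =>
    -- In e = s(e) · e · r(e) the source carries the indices (m, 0), the edge (0, 0) and the range
    -- (0, n).
    rw [← source_mul_edge, ← h.mul_same m 0 n, ← edge_mul_range, ← h.mul_same 0 0 n]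
    exact mul_mem (hv _ _ _) (mul_mem ⟨_, h.stabHom_edge_baseEdge e⟩ (hv _ _ _))
  | hg e =>
    rw [← range_mul_ghost, ← h.mul_same m 0 n, ← ghost_mul_source, ← h.mul_same 0 0 n]
    exact mul_mem (hv _ _ _) (mul_mem ⟨_, h.stabHom_ghost_baseEdge e⟩ (hv _ _ _))
  | h0 => exact ⟨0, by rw [map_zero, map_zero]⟩
  | hadd a b ha hb =>
    obtain ⟨a', ha'⟩ := ha m n
    obtain ⟨b', hb'⟩ := hb m n
    exact ⟨a' + b', by rw [map_add, map_add, ha', hb']⟩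
  | hmul a b ha hb =>
    rw [← h.mul_same m 0 n]
    exact mul_mem (ha m 0) (hb 0 n)
  | hsmul c a ha =>
    obtain ⟨a', ha'⟩ := ha m n
    exact ⟨c • a', by rw [map_smul, map_smul, ha']⟩

/-- A compression of an element z of the kernel comes from some a at level 0 with τ 0 0 a = 0, so it
vanishes. Multiplying back by paths and ghost paths gives p z q = 0 for all vertices p and q, and
finite sums of vertices are local units for z. -/
theorem stabHom_injective (h0 : Function.Injective (τ 0 0)) : Function.Injective h.stabHom := by
  refine (injective_iff_map_eq_zero _).2 fun z hz => ?_
  have key : ∀ p q : E.stabilization.Vertex, vertex K p * (z * vertex K q) = 0 := by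
    intro p q
    obtain ⟨x, m, rfl⟩ := exists_eq_stabVertex p
    obtain ⟨y, n, rfl⟩ := exists_eq_stabVertex q
    obtain ⟨a, ha⟩ := headGhost_mul_mul_headPath_mem x y m n z
    have h1 : τ 0 0 a = 0 := by
      rw [← h.stabHom_baseHom, ha, map_mul, map_mul, hz, mul_zero, zero_mul]
    rw [(injective_iff_map_eq_zero (τ 0 0)).1 h0 a h1, map_zero] at ha
    have h2 : vertex K (stabVertex x m) * (z * vertex K (stabVertex y n)) =
        headPath K x m * (headGhost K x m * z * headPath K y n) * headGhost K y n := by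
      rw [← headPath_mul_headGhost_self, ← headPath_mul_headGhost_self]
      simp only [mul_assoc]
    rw [h2, ← ha, mul_zero, zero_mul]
  obtain ⟨F, hF⟩ := exists_sum_vertex_mul K z
  obtain ⟨G, hG⟩ := exists_sum_mul_vertex K z
  rw [← hF]
  refine Finset.sum_eq_zero fun p _ => ?_
  rw [← hG, Finset.mul_sum]
  exact Finset.sum_eq_zero fun q _ => key p q

end IsMatrixSystem

/-! ### Compatibility with the involutions. -/

section Star

variable {K : Type w} [Field K] [StarRing K] {E : DirectedGraph.{u, v}} {R : Type*}
  [NonUnitalRing R] [StarRing R] [Module K R] [StarModule K R]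

theorem map_star_of_generators {φ : LeavittPathAlgebra K E →ₙₐ[K] R}
    (hV : ∀ x, star (φ (vertex K x)) = φ (vertex K x))
    (hE : ∀ e, star (φ (edge K e)) = φ (ghost K e)) (z : LeavittPathAlgebra K E) :
    φ (star z) = star (φ z) := by
  induction z using LeavittPathAlgebra.induction with
  | hv x => rw [star_vertex, hV]
  | he e => rw [star_edge, hE]
  | hg e => rw [star_ghost, ← hE, star_star]
  | h0 => rw [star_zero, map_zero, star_zero]
  | hadd x y hx hy => rw [star_add, map_add, map_add, star_add, hx, hy]
  | hmul x y hx hy => rw [star_mul, map_mul, map_mul, star_mul, hx, hy]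
  | hsmul c x hx => rw [star_smul, map_smul, map_smul, star_smul, hx]

theorem baseHom_star (a : LeavittPathAlgebra K E) :
    baseHom K E (star a) = star (baseHom K E a) :=
  map_star_of_generators (fun x => by rw [baseHom_vertex, star_vertex])
    (fun e => by rw [baseHom_edge, baseHom_ghost, star_edge]) a

theorem IsMatrixSystem.stabHom_star [IsScalarTower K R R] [SMulCommClass K R R]
    {τ : ℕ → ℕ → LeavittPathAlgebra K E →ₗ[K] R} (h : IsMatrixSystem τ)
    (hτ : ∀ m n a, star (τ m n a) = τ n m (star a)) (z : LeavittPathAlgebra K E.stabilization) :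
    h.stabHom (star z) = star (h.stabHom z) := by
  refine map_star_of_generators (fun p => ?_) (fun e => ?_) z
  · obtain ⟨x, n, rfl⟩ := exists_eq_stabVertex p
    rw [stabHom_vertex, hτ, star_vertex]
  · rcases stabilization_edge_cases e with ⟨f, rfl⟩ | ⟨y, m, rfl⟩
    · rw [stabHom_edge_baseEdge, stabHom_ghost_baseEdge, hτ, star_edge]
    · rw [stabHom_edge_headEdge, stabHom_ghost_headEdge, hτ, star_vertex]

end Star

end LeavittPathAlgebra

/-! ### Matrix units in `M_∞(R)` -/

namespace MInfty

variable {K R : Type*} [Semiring K] [NonUnitalRing R] [Module K R]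

variable (K R) in
/-- The matrix with entry `a` in position `(m, n)` and zeros elsewhere. -/
noncomputable def single (m n : ℕ) : R →ₗ[K] MInfty R where
  toFun a := ⟨fun i j => if i = m ∧ j = n then a else 0,
    finite_of_bound (f := fun i j => if i = m ∧ j = n then a else 0) (m + n + 1)
      fun i j h => if_neg fun h' => by omega⟩
  map_add' a b := by
    ext i j
    simp only [add_entry]
    split_ifs <;> simp
  map_smul' c a := by
    ext i j
    simp only [smul_entry, RingHom.id_apply]
    split_ifs <;> simp

theorem single_entry (m n : ℕ) (a : R) (i j : ℕ) :
    (single K R m n a).entry i j = if i = m ∧ j = n then a else 0 := rfl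

theorem isMatrixSystem_single :
    LeavittPathAlgebra.IsMatrixSystem (single K R) where
  mul_same l m n a b := by
    ext i j
    rw [mul_entry, finsum_eq_single _ m fun k hk => by simp [single_entry, hk]]
    simp only [single_entry]
    split_ifs <;> simp_all
  mul_of_ne k l m n a b hlm := by
    ext i j
    rw [mul_entry, zero_entry]
    refine (finsum_congr fun p => ?_).trans finsum_zero
    simp only [single_entry]
    split_ifs <;> simp_all

theorem single_injective (m n : ℕ) : Function.Injective (single K R m n) := fun a b h => by
  simpa [single_entry] using congrArg (fun A => A.entry m n) h

theorem star_single [StarRing R] (m n : ℕ) (a : R) :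
    star (single K R m n a) = single K R n m (star a) := by
  ext i j
  simp only [star_entry, single_entry, apply_ite star, star_zero, and_comm]

theorem sum_entry {ι : Type*} (F : Finset ι) (f : ι → MInfty R) (i j : ℕ) :
    (∑ k ∈ F, f k).entry i j = ∑ k ∈ F, (f k).entry i j := by
  classical
  induction F using Finset.induction_on with
  | empty => simp
  | insert a s ha ih => rw [Finset.sum_insert ha, Finset.sum_insert ha, add_entry, ih]

-- Reduces surjectivity onto the matrix algebra to matrices with one nonzero entry.
variable (K) in
theorem exists_eq_sum_single (A : MInfty R) :
    ∃ N, A = ∑ m ∈ Finset.range N, ∑ n ∈ Finset.range N, single K R m n (A.entry m n) := by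
  obtain ⟨N, hN⟩ := A.exists_bound
  refine ⟨N, ?_⟩
  ext i j
  simp only [sum_entry, single_entry, ite_and, Finset.sum_ite_irrel, Finset.sum_const_zero,
    Finset.sum_ite_eq, Finset.mem_range]
  split_ifs with h1 h2
  · rfl
  · exact hN i j (Or.inr (not_lt.1 h2))
  · exact hN i j (Or.inl (not_lt.1 h1))

end MInfty

/-! ### The isomorphism with the matrix algebra. -/

namespace LeavittPathAlgebra

variable (K : Type w) [Field K] (E : DirectedGraph.{u, v})

theorem bijective_stabHom_single :
    Function.Bijective (MInfty.isMatrixSystem_single (K := K)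
      (R := LeavittPathAlgebra K E)).stabHom := by
  set h := MInfty.isMatrixSystem_single (K := K) (R := LeavittPathAlgebra K E)
  refine ⟨h.stabHom_injective (MInfty.single_injective 0 0), fun A => ?_⟩
  obtain ⟨N, hN⟩ := A.exists_eq_sum_single K
  choose z hz using fun m n => h.mem_range_stabHom m n (A.entry m n)
  refine ⟨∑ m ∈ Finset.range N, ∑ n ∈ Finset.range N, z m n, ?_⟩
  simp only [map_sum, hz]
  exact hN.symm

/-- The Leavitt path algebra of the stabilization is isomorphic to an algebra of matrices. -/
theorem exists_bijective_hom_minfty :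
    ∃ φ : LeavittPathAlgebra K E.stabilization →ₙₐ[K] MInfty (LeavittPathAlgebra K E),
      Function.Bijective φ :=
  ⟨_, bijective_stabHom_single K E⟩

theorem nonempty_starAlgEquiv_minfty [StarRing K] :
    Nonempty (LeavittPathAlgebra K E.stabilization ≃⋆ₐ[K] MInfty (LeavittPathAlgebra K E)) := by
  let φ : LeavittPathAlgebra K E.stabilization →⋆ₙₐ[K] MInfty (LeavittPathAlgebra K E) :=
    { MInfty.isMatrixSystem_single.stabHom with
      map_star' := MInfty.isMatrixSystem_single.stabHom_star MInfty.star_single }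
  exact ⟨StarAlgEquiv.ofBijective φ (bijective_stabHom_single K E)⟩

end LeavittPathAlgebra

/-! ### Matrix units in the algebra of compact operators -/

section HilbertBasis

open Filter Topology InnerProductSpace

variable {H : Type*} [NormedAddCommGroup H] [InnerProductSpace ℂ H]

/-- Distinct members have distance √2, so the balls of radius 1/2 around them are disjoint, and a
separable space contains only countably many disjoint nonempty open sets. -/
theorem Orthonormal.countable_of_separableSpace {ι : Type*} [TopologicalSpace.SeparableSpace H]
    {e : ι → H} (he : Orthonormal ℂ e) : Countable ι := by
  refine Pairwise.countable_of_isOpen_disjoint (s := fun i => Metric.ball (e i) (1 / 2))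
    (fun i j hij => ?_) (fun i => Metric.isOpen_ball) fun i => ⟨e i, by simp⟩
  refine Metric.ball_disjoint_ball ?_
  have h1 : ‖e i - e j‖ ^ 2 = 2 := by
    rw [@norm_sub_sq ℂ, he.1, he.1, he.2 hij]
    norm_num
  rw [dist_eq_norm]
  nlinarith [norm_nonneg (e i - e j)]

variable (H) in
theorem nonempty_hilbertBasis_nat [CompleteSpace H] [TopologicalSpace.SeparableSpace H]
    (hH : ¬ FiniteDimensional ℂ H) : Nonempty (HilbertBasis ℕ ℂ H) := by
  obtain ⟨w, b, -⟩ := exists_hilbertBasis ℂ H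
  have := b.orthonormal.countable_of_separableSpace
  have : Infinite w := by
    by_contra h
    have : Finite w := not_infinite_iff_finite.1 h
    have := Fintype.ofFinite w
    exact hH (Module.Basis.finiteDimensional_of_finite b.toOrthonormalBasis.toBasis)
  have := Encodable.ofCountable w
  have := Denumerable.ofEncodableOfInfinite w
  let f : ℕ ≃ w := (Denumerable.eqv w).symm
  refine ⟨HilbertBasis.mk (v := b ∘ f) (b.orthonormal.comp f f.injective) ?_⟩
  rw [Set.range_comp, f.range_eq_univ, Set.image_univ, b.dense_span]

namespace HilbertBasis

variable (b : HilbertBasis ℕ ℂ H)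

/-- The orthogonal projection onto the span of the first `N` vectors of a Hilbert basis. -/
noncomputable def proj (N : ℕ) : H →L[ℂ] H := ∑ i ∈ Finset.range N, rankOne ℂ (b i) (b i)

theorem proj_apply (N : ℕ) (x : H) :
    b.proj N x = ∑ i ∈ Finset.range N, inner ℂ (b i) x • b i := by
  simp [proj]

theorem proj_mul_self (N : ℕ) : b.proj N * b.proj N = b.proj N := by
  simp only [proj, Finset.sum_mul_sum, ContinuousLinearMap.mul_def, rankOne_comp_rankOne,
    orthonormal_iff_ite.1 b.orthonormal, ite_smul, one_smul, zero_smul, Finset.sum_ite_eq]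
  exact Finset.sum_congr rfl fun i hi => if_pos hi

theorem tendsto_proj_apply (x : H) : Tendsto (fun N => b.proj N x) atTop (𝓝 x) := by
  simp only [proj_apply, ← b.repr_apply_apply]
  exact (b.hasSum_repr x).tendsto_sum_nat

/-- Together with `tendsto_proj_mul_mul_proj` this approximates compact operators by combinations of
matrix units. -/
theorem proj_mul_mul_proj (T : H →L[ℂ] H) (N : ℕ) : b.proj N * T * b.proj N =
    ∑ m ∈ Finset.range N, ∑ n ∈ Finset.range N,
      inner ℂ (b m) (T (b n)) • rankOne ℂ (b m) (b n) := by
  ext x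
  change b.proj N (T (b.proj N x)) = _
  rw [proj_apply]
  simp only [proj_apply, map_sum, map_smul, inner_sum, inner_smul_right, Finset.sum_smul, sum_apply,
    smul_apply, rankOne_apply, smul_smul]
  exact Finset.sum_congr rfl fun m _ => Finset.sum_congr rfl fun n _ => by rw [mul_comm]

theorem isCompactOperator_rankOne (x y : H) : IsCompactOperator (rankOne ℂ x y) := by
  rw [rankOne_def']
  exact (isCompactOperator_of_locallyCompactSpace_rng
    (ContinuousLinearMap.toSpanSingleton ℂ x)).comp_clm (innerSL ℂ y)

variable [CompleteSpace H]

theorem star_proj (N : ℕ) : star (b.proj N) = b.proj N := by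
  rw [proj, star_sum]
  exact Finset.sum_congr rfl fun i _ => adjoint_rankOne (b i) (b i)

theorem norm_proj_le (N : ℕ) : ‖b.proj N‖ ≤ 1 := by
  have h : ‖b.proj N‖ = ‖b.proj N‖ * ‖b.proj N‖ := by
    rw [← CStarRing.norm_star_mul_self, star_proj, proj_mul_self]
  by_contra! h1
  nlinarith

/-- The projections are contractions that converge pointwise to the identity, hence uniformly on the
totally bounded image of the unit ball under T. -/
theorem tendsto_proj_mul {T : H →L[ℂ] H} (hT : IsCompactOperator T) :
    Tendsto (fun N => b.proj N * T) atTop (𝓝 T) := by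
  rw [Metric.tendsto_atTop]
  intro ε hε
  have htb := (hT.isCompact_closure_image_closedBall (f := (T : H →ₗ[ℂ] H)) 1).totallyBounded.subset
    subset_closure
  rw [Metric.totallyBounded_iff] at htb
  -- Three errors of at most ε / 4 will be added; the sum 3ε / 4 leaves the strict inequality after
  -- the supremum over unit vectors.
  obtain ⟨t, ht, hcov⟩ := htb (ε / 4) (by positivity)
  have hev : ∀ᶠ N in atTop, ∀ y ∈ t, dist (b.proj N y) y < ε / 4 :=
    (eventually_all_finite ht).2 fun y _ =>
      (Metric.tendsto_nhds.1 (b.tendsto_proj_apply y)) (ε / 4) (by positivity)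
  obtain ⟨M, hM⟩ := eventually_atTop.1 hev
  refine ⟨M, fun N hN => ?_⟩
  rw [dist_eq_norm]
  refine lt_of_le_of_lt (ContinuousLinearMap.opNorm_le_of_unit_norm (C := 3 * (ε / 4))
    (by positivity) fun x hx => ?_) (by linarith)
  obtain ⟨y, hy, hxy⟩ := Set.mem_iUnion₂.mp (hcov ⟨x, by simp [hx], rfl⟩)
  have h1 : ‖T x - y‖ < ε / 4 := by rw [← dist_eq_norm]; exact hxy
  have h2 : ‖b.proj N y - y‖ < ε / 4 := by rw [← dist_eq_norm]; exact hM N hN y hy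
  have h3 : ‖b.proj N (T x - y)‖ ≤ ‖T x - y‖ := by
    simpa using (b.proj N).le_of_opNorm_le (b.norm_proj_le N) (T x - y)
  have h4 : (b.proj N * T - T) x = b.proj N (T x - y) + (b.proj N y - y) - (T x - y) := by
    rw [map_sub]
    change b.proj N (T x) - T x = _
    abel
  rw [h4]
  have := norm_sub_le (b.proj N (T x - y) + (b.proj N y - y)) (T x - y)
  have := norm_add_le (b.proj N (T x - y)) (b.proj N y - y)
  linarith

/-- The adjoint of `tendsto_proj_mul` for T*, which is again compact. -/
theorem tendsto_mul_proj {T : H →L[ℂ] H} (hT : IsCompactOperator T) :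
    Tendsto (fun N => T * b.proj N) atTop (𝓝 T) := by
  have h := (b.tendsto_proj_mul (isCompactOperator_star hT)).star
  simpa only [star_mul, star_star, star_proj] using h

theorem tendsto_proj_mul_mul_proj {T : H →L[ℂ] H} (hT : IsCompactOperator T) :
    Tendsto (fun N => b.proj N * T * b.proj N) atTop (𝓝 T) := by
  have h1 := tendsto_iff_norm_sub_tendsto_zero.1 (b.tendsto_proj_mul hT)
  have h2 := tendsto_iff_norm_sub_tendsto_zero.1 (b.tendsto_mul_proj hT)
  rw [tendsto_iff_norm_sub_tendsto_zero]
  refine squeeze_zero (fun _ => norm_nonneg _) (fun N => ?_) (by simpa using h2.add h1)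
  have h3 : b.proj N * T * b.proj N - T = b.proj N * (T * b.proj N - T) + (b.proj N * T - T) := by
    noncomm_ring
  rw [h3]
  refine (norm_add_le _ _).trans (add_le_add_left ((norm_mul_le _ _).trans ?_) _)
  exact mul_le_of_le_one_left (norm_nonneg _) (b.norm_proj_le N)

/-- The matrix units of the algebra of compact operators given by a Hilbert basis. -/
noncomputable def matrixUnit (m n : ℕ) : compactOperators H :=
  ⟨rankOne ℂ (b m) (b n), isCompactOperator_rankOne (b m) (b n)⟩

theorem matrixUnit_mul_same (l m n : ℕ) :
    b.matrixUnit l m * b.matrixUnit m n = b.matrixUnit l n := by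
  refine Subtype.ext ?_
  change rankOne ℂ (b l) (b m) ∘L rankOne ℂ (b m) (b n) = rankOne ℂ (b l) (b n)
  rw [rankOne_comp_rankOne, orthonormal_iff_ite.1 b.orthonormal, if_pos rfl, one_smul]

theorem matrixUnit_mul_of_ne (k l m n : ℕ) (h : l ≠ m) :
    b.matrixUnit k l * b.matrixUnit m n = 0 := by
  refine Subtype.ext ?_
  change rankOne ℂ (b k) (b l) ∘L rankOne ℂ (b m) (b n) = 0
  rw [rankOne_comp_rankOne, orthonormal_iff_ite.1 b.orthonormal, if_neg h, zero_smul]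

theorem star_matrixUnit (m n : ℕ) : star (b.matrixUnit m n) = b.matrixUnit n m :=
  Subtype.ext (adjoint_rankOne (b m) (b n))

theorem inner_matrixUnit (m n i j : ℕ) :
    inner ℂ (b i) ((b.matrixUnit m n : H →L[ℂ] H) (b j)) = if i = m ∧ n = j then 1 else 0 := by
  change inner ℂ (b i) (rankOne ℂ (b m) (b n) (b j)) = _
  rw [inner_right_rankOne_apply, orthonormal_iff_ite.1 b.orthonormal,
    orthonormal_iff_ite.1 b.orthonormal, ite_and]
  split_ifs <;> simp

theorem tendsto_sum_matrixUnit (T : compactOperators H) :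
    Tendsto (fun N => ∑ m ∈ Finset.range N, ∑ n ∈ Finset.range N,
      inner ℂ (b m) ((T : H →L[ℂ] H) (b n)) • b.matrixUnit m n) atTop (𝓝 T) := by
  rw [tendsto_subtype_rng]
  convert b.tendsto_proj_mul_mul_proj T.2 using 2 with N
  rw [proj_mul_mul_proj]
  simp only [AddSubmonoidClass.coe_finsetSum]
  rfl

end HilbertBasis

end HilbertBasis

/-! ### A C*-seminorm on the tensor product with the compact operators -/

section Compression

open Filter Topology
open scoped TensorProduct

/-- If x > y > 0, the powers of x / y are unbounded and cannot stay below C. This removes a constant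
from a norm estimate that can be squared repeatedly. -/
theorem le_of_forall_pow_two_pow_le {x y C : ℝ} (hy : 0 ≤ y)
    (h : ∀ k : ℕ, x ^ 2 ^ k ≤ C * y ^ 2 ^ k) : x ≤ y := by
  by_contra! hlt
  rcases hy.eq_or_lt with rfl | hy
  · have := h 0
    norm_num at this
    linarith
  · obtain ⟨n, hn⟩ := pow_unbounded_of_one_lt C ((one_lt_div hy).2 hlt)
    have h1 : (x / y) ^ n ≤ (x / y) ^ 2 ^ n :=
      pow_le_pow_right₀ ((one_lt_div hy).2 hlt).le Nat.lt_two_pow_self.le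
    have h2 : (x / y) ^ 2 ^ n ≤ C := by
      rw [div_pow, div_le_iff₀ (by positivity)]
      exact h n
    linarith

variable {A : Type*} [NonUnitalCStarAlgebra A]
variable {H : Type*} [NormedAddCommGroup H] [InnerProductSpace ℂ H]

namespace HilbertBasis

variable (b : HilbertBasis ℕ ℂ H)

/-- The `N × N`-matrix over `A` that is obtained from `a ⊗ T` by compression. -/
noncomputable def compress (N : ℕ) : A →ₗ[ℂ] (H →L[ℂ] H) →ₗ[ℂ] CStarMatrix (Fin N) (Fin N) A :=
  LinearMap.mk₂ ℂ (fun a T => CStarMatrix.ofMatrix fun i j => inner ℂ (b i) (T (b j)) • a)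
    (fun _ _ _ => CStarMatrix.ext fun _ _ => smul_add _ _ _)
    (fun _ _ _ => CStarMatrix.ext fun _ _ => smul_comm _ _ _)
    (fun a _ _ => CStarMatrix.ext fun _ _ =>
      (congrArg (· • a) (inner_add_right _ _ _)).trans (add_smul _ _ _))
    (fun _ a _ => CStarMatrix.ext fun _ _ =>
      (congrArg (· • a) (inner_smul_right _ _ _)).trans (mul_smul _ _ _))

theorem compress_apply (N : ℕ) (a : A) (T : H →L[ℂ] H) (i j : Fin N) :
    b.compress N a T i j = inner ℂ (b i) (T (b j)) • a := rfl

/-- The matrix product sums over the first N basis vectors only, which puts the projection between T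
and T'. Compression is thus multiplicative only in the limit. -/
theorem compress_mul (N : ℕ) (a a' : A) (T T' : H →L[ℂ] H) :
    b.compress N a T * b.compress N a' T' = b.compress N (a * a') (T * b.proj N * T') := by
  ext i j
  rw [CStarMatrix.mul_apply]
  simp only [compress_apply, smul_mul_smul_comm, ← Finset.sum_smul]
  congr 1
  change _ = inner ℂ (b i) (T (b.proj N (T' (b j))))
  rw [proj_apply, map_sum, inner_sum, ← Fin.sum_univ_eq_sum_range (fun k =>
    inner ℂ (b i) (T (inner ℂ (b k) (T' (b j)) • b k)))]
  refine Finset.sum_congr rfl fun k _ => ?_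
  rw [map_smul, inner_smul_right, mul_comm]

/-- The C*-norm on matrices is bounded by a multiple of the maximum norm of the entries. The
constant may depend on N; `norm_compress_le` replaces it by 1. -/
theorem exists_norm_compress_le [PartialOrder A] [StarOrderedRing A] (N : ℕ) :
    ∃ C : ℝ, ∀ (a : A) (T : H →L[ℂ] H), ‖b.compress N a T‖ ≤ C * (‖a‖ * ‖T‖) := by
  let L : (Fin N → Fin N → A) →L[ℂ] CStarMatrix (Fin N) (Fin N) A :=
    (CStarMatrix.ofMatrixL (m := Fin N) (n := Fin N) (A := A)).toContinuousLinearMap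
  refine ⟨‖L‖, fun a T => ?_⟩
  refine (L.le_opNorm fun i j => inner ℂ (b i) (T (b j)) • a).trans ?_
  refine mul_le_mul_of_nonneg_left ?_ (norm_nonneg _)
  refine (pi_norm_le_iff_of_nonneg (by positivity)).2 fun i =>
    (pi_norm_le_iff_of_nonneg (by positivity)).2 fun j => ?_
  rw [norm_smul, mul_comm]
  refine mul_le_mul_of_nonneg_left ?_ (norm_nonneg _)
  refine (norm_inner_le_norm _ _).trans ?_
  rw [b.orthonormal.1, one_mul]
  simpa [b.orthonormal.1] using T.le_opNorm (b j)

variable [CompleteSpace H]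

theorem star_compress (N : ℕ) (a : A) (T : H →L[ℂ] H) :
    star (b.compress N a T) = b.compress N (star a) (star T) := by
  ext i j
  rw [CStarMatrix.star_apply, compress_apply, compress_apply, star_smul,
    ContinuousLinearMap.star_eq_adjoint, ContinuousLinearMap.adjoint_inner_right]
  congr 1
  exact inner_conj_symm _ _

/-- The compression of elements of `A ⊗ K` to `N × N`-matrices over `A`. -/
noncomputable def compressTensor (N : ℕ) :
    A ⊗[ℂ] compactOperators H →ₗ[ℂ] CStarMatrix (Fin N) (Fin N) A :=
  TensorProduct.lift ((b.compress N).compl₂ (compactOperators H).toSubmodule.subtype)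

theorem compressTensor_tmul (N : ℕ) (a : A) (T : compactOperators H) :
    b.compressTensor N (a ⊗ₜ[ℂ] T) = b.compress N a (T : H →L[ℂ] H) := rfl

theorem compressTensor_star (N : ℕ) (x : A ⊗[ℂ] compactOperators H) :
    b.compressTensor N (star x) = star (b.compressTensor N x) := by
  induction x with
  | zero => rw [star_zero, map_zero, star_zero]
  | tmul a T =>
    rw [TensorProduct.star_tmul, compressTensor_tmul, compressTensor_tmul, star_compress]
    rfl
  | add x y hx hy => rw [star_add, map_add, map_add, star_add, hx, hy]

variable [PartialOrder A] [StarOrderedRing A]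

/-- By the C*-identity, squaring the left side turns the pair (a, T) into (a*a, T*PT), whose norms
are at most the squares of the old ones. Iteration gives the estimate for all powers 2^k with the
same constant C, which then disappears. -/
theorem norm_compress_le (N : ℕ) (a : A) (T : H →L[ℂ] H) :
    ‖b.compress N a T‖ ≤ ‖a‖ * ‖T‖ := by
  obtain ⟨C, hC⟩ := b.exists_norm_compress_le (A := A) N
  have hC0 : 0 ≤ |C| := abs_nonneg C
  refine le_of_forall_pow_two_pow_le (C := |C|) (by positivity) fun k => ?_
  induction k generalizing a T with
  | zero =>
    simp only [pow_zero, pow_one]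
    exact (hC a T).trans (mul_le_mul_of_nonneg_right (le_abs_self C) (by positivity))
  | succ k ih =>
    have h1 : ‖b.compress N a T‖ ^ 2 =
        ‖b.compress N (star a * a) (star T * b.proj N * T)‖ := by
      rw [← compress_mul, ← star_compress, CStarRing.norm_star_mul_self, sq]
    have h2 : ‖star T * b.proj N * T‖ ≤ ‖T‖ ^ 2 := by
      refine (norm_mul_le _ _).trans ?_
      rw [sq]
      refine mul_le_mul_of_nonneg_right ((norm_mul_le _ _).trans ?_) (norm_nonneg _)
      rw [norm_star]
      exact mul_le_of_le_one_right (norm_nonneg _) (b.norm_proj_le N)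
    have h3 : ‖star a * a‖ = ‖a‖ ^ 2 := by rw [CStarRing.norm_star_mul_self, sq]
    rw [pow_succ', pow_mul, h1]
    refine (ih _ _).trans (mul_le_mul_of_nonneg_left ?_ hC0)
    rw [pow_mul, h3, mul_pow ‖a‖ ‖T‖ 2]
    gcongr

theorem exists_norm_compressTensor_le (x : A ⊗[ℂ] compactOperators H) :
    ∃ M, ∀ N, ‖b.compressTensor N x‖ ≤ M := by
  induction x with
  | zero => exact ⟨0, fun N => by rw [map_zero, norm_zero]⟩
  | tmul a T => exact ⟨‖a‖ * ‖T‖, fun N => b.norm_compress_le N a T⟩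
  | add x y hx hy =>
    obtain ⟨M, hM⟩ := hx
    obtain ⟨M', hM'⟩ := hy
    exact ⟨M + M', fun N => by
      rw [map_add]
      exact (norm_add_le _ _).trans (add_le_add (hM N) (hM' N))⟩

/-- For elementary tensors the difference is the compression of aa' ⊗ T(T' − PT'), and PT' → T' in
norm because T' is compact. The bound of `norm_compress_le`, uniform in N, is essential. -/
theorem tendsto_norm_compressTensor_mul_sub (x y : A ⊗[ℂ] compactOperators H) :
    Tendsto (fun N => ‖b.compressTensor N (x * y) - b.compressTensor N x * b.compressTensor N y‖)
      atTop (𝓝 0) := by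
  induction x with
  | zero => simp
  | tmul a T =>
    induction y with
    | zero => simp
    | tmul a' T' =>
      have h1 : Tendsto (fun N => ‖a * a'‖ *
          ‖(T : H →L[ℂ] H) * (T' - b.proj N * (T' : H →L[ℂ] H))‖) atTop (𝓝 0) := by
        have := ((b.tendsto_proj_mul T'.2).const_sub (T' : H →L[ℂ] H)).const_mul (T : H →L[ℂ] H)
        simpa using this.norm.const_mul ‖a * a'‖
      refine squeeze_zero (fun _ => norm_nonneg _) (fun N => ?_) h1
      rw [Algebra.TensorProduct.tmul_mul_tmul, compressTensor_tmul, compressTensor_tmul,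
        compressTensor_tmul, compress_mul, ← map_sub]
      refine (b.norm_compress_le N _ _).trans_eq ?_
      rw [mul_sub, mul_assoc]
      rfl
    | add y z hy hz =>
      refine squeeze_zero (fun _ => norm_nonneg _) (fun N => ?_) (by simpa using hy.add hz)
      rw [mul_add, map_add, map_add, mul_add, add_sub_add_comm]
      exact norm_add_le _ _
  | add x z hx hz =>
    refine squeeze_zero (fun _ => norm_nonneg _) (fun N => ?_) (by simpa using hx.add hz)
    rw [add_mul, map_add, map_add, add_mul, add_sub_add_comm]
    exact norm_add_le _ _

end HilbertBasis

end Compression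

section Seminorm

open Filter Topology
open scoped TensorProduct

variable {A : Type*} [NonUnitalCStarAlgebra A]
variable {H : Type*} [NormedAddCommGroup H] [InnerProductSpace ℂ H] [CompleteSpace H]

/-- There is a C*-seminorm on `A ⊗ K` that restricts to the norm of `A` on the corner given by a
minimal projection. -/
theorem HilbertBasis.exists_mem_tensorSeminorms (b : HilbertBasis ℕ ℂ H) :
    ∃ γ ∈ tensorSeminorms A (compactOperators H),
      ∀ a, ‖a‖ ≤ γ (a ⊗ₜ[ℂ] b.matrixUnit 0 0) := by
  -- The norm of `CStarMatrix` refers to an order on the coefficients; the spectral order is always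
  -- available.
  let _ := CStarAlgebra.spectralOrder A
  have := CStarAlgebra.spectralOrderedRing A
  -- A bounded sequence converges along an ultrafilter, so convergence of the norms along ℕ need not
  -- be shown.
  have hex : ∀ x : A ⊗[ℂ] compactOperators H, ∃ r, Tendsto (fun N => ‖b.compressTensor N x‖)
      (hyperfilter ℕ : Filter ℕ) (𝓝 r) := by
    intro x
    obtain ⟨M, hM⟩ := b.exists_norm_compressTensor_le x
    obtain ⟨r, -, hr⟩ := (isCompact_Icc (a := 0) (b := M)).ultrafilter_le_nhds
      ((hyperfilter ℕ).map fun N => ‖b.compressTensor N x‖)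
      (by
        rw [Ultrafilter.coe_map, le_principal_iff]
        exact mem_map.2 (univ_mem' fun N => ⟨norm_nonneg _, hM N⟩))
    exact ⟨r, hr⟩
  choose g hg using hex
  have hsub : ∀ x y : A ⊗[ℂ] compactOperators H, Tendsto (fun N => ‖b.compressTensor N (x * y) -
      b.compressTensor N x * b.compressTensor N y‖) (hyperfilter ℕ : Filter ℕ) (𝓝 0) :=
    fun x y => (b.tendsto_norm_compressTensor_mul_sub x y).mono_left Nat.hyperfilter_le_atTop
  -- Asymptotic multiplicativity lets submultiplicativity and the C*-identity of the matrix norms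
  -- pass to the limit.
  have hmul : ∀ x y : A ⊗[ℂ] compactOperators H, Tendsto (fun N => ‖b.compressTensor N x * b.compressTensor N y‖)
      (hyperfilter ℕ : Filter ℕ) (𝓝 (g (x * y))) := by
    intro x y
    have h1 : Tendsto (fun N => ‖b.compressTensor N x * b.compressTensor N y‖ -
        ‖b.compressTensor N (x * y)‖) (hyperfilter ℕ : Filter ℕ) (𝓝 0) := by
      refine squeeze_zero_norm (fun N => ?_) (hsub x y)
      rw [norm_sub_rev (b.compressTensor N (x * y))]
      exact abs_norm_sub_norm_le _ _
    simpa using h1.add (hg (x * y))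
  let γ : CStarSeminorm (A ⊗[ℂ] compactOperators H) :=
    { toFun := g
      map_zero' := tendsto_nhds_unique (hg 0) (by simp)
      add_le' := fun x y => le_of_tendsto_of_tendsto' (hg (x + y)) ((hg x).add (hg y)) fun N => by
        rw [map_add]; exact norm_add_le _ _
      neg' := fun x => tendsto_nhds_unique (hg (-x)) (by simpa using hg x)
      smul' := fun c x => tendsto_nhds_unique (hg (c • x)) (by
        simpa [norm_smul] using (hg x).const_mul ‖c‖)
      mul_le' := fun x y => le_of_tendsto_of_tendsto' (hmul x y) ((hg x).mul (hg y)) fun N =>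
        norm_mul_le _ _
      star_mul_self' := fun x => tendsto_nhds_unique (hmul (star x) x) (by
        simpa only [b.compressTensor_star, CStarRing.norm_star_mul_self] using (hg x).mul (hg x)) }
  refine ⟨γ, fun a T => ?_, fun a => ?_⟩
  · exact le_of_tendsto' (hg (a ⊗ₜ[ℂ] T)) fun N => b.norm_compress_le N a T
  · refine ge_of_tendsto (hg (a ⊗ₜ[ℂ] b.matrixUnit 0 0)) ?_
    -- For N ≥ 1 the matrix has an entry at (0, 0), and this entry is a.
    refine Nat.hyperfilter_le_atTop ((eventually_ge_atTop 1).mono fun N hN => ?_)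
    have h1 : b.compressTensor N (a ⊗ₜ[ℂ] b.matrixUnit 0 0) ⟨0, hN⟩ ⟨0, hN⟩ = a := by
      rw [b.compressTensor_tmul, b.compress_apply, b.inner_matrixUnit]
      simp
    conv_lhs => rw [← h1]
    exact CStarMatrix.norm_entry_le_norm

end Seminorm

/-! ### Passage to graph C*-algebras. -/

namespace GraphCStarAlgebra

open LeavittPathAlgebra DirectedGraph

/-- The canonical `*`-homomorphism from the complex Leavitt path algebra to the graph
C*-algebra. -/
noncomputable abbrev ofLeavitt (E : DirectedGraph.{u, v}) :
    LeavittPathAlgebra ℂ E →⋆ₙₐ[ℂ] GraphCStarAlgebra E :=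
  (graphCStarSeminorm E).toCompletion

theorem denseRange_ofLeavitt (E : DirectedGraph.{u, v}) : DenseRange (ofLeavitt E) :=
  (graphCStarSeminorm E).denseRange_toCompletion

/-- A `*`-homomorphism from the complex Leavitt path algebra to a C*-algebra extends to the graph
C*-algebra. -/
theorem exists_extension {E : DirectedGraph.{u, v}} {C : Type*} [NonUnitalCStarAlgebra C]
    (φ : LeavittPathAlgebra ℂ E →⋆ₙₐ[ℂ] C) :
    ∃ ψ : GraphCStarAlgebra E →⋆ₙₐ[ℂ] C, Continuous ψ ∧ ∀ x, ψ (ofLeavitt E x) = φ x :=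
  (graphCStarSeminorm E).exists_extension φ fun x =>
    le_ciSup (bddAbove_leavitt_cstarSeminorm E x) ⟨CStarSeminorm.ofHom φ, trivial⟩

/-- An element of a graph C*-algebra is zero if it is annihilated by all pairs of vertices. -/
theorem eq_zero_of_forall_vertex {E : DirectedGraph.{u, v}} {z : GraphCStarAlgebra E}
    (hz : ∀ p q, vertex p * z * vertex q = 0) : z = 0 := by
  have left : ∀ z' : GraphCStarAlgebra E, (∀ p, vertex p * z' = 0) → ∀ c, c * z' = 0 := by
    intro z' h c
    refine (denseRange_ofLeavitt E).induction_on c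
      (isClosed_eq (continuous_mul_const z') continuous_const) fun w => ?_
    obtain ⟨F, hF⟩ := exists_sum_mul_vertex ℂ w
    rw [← hF, map_sum, Finset.sum_mul]
    refine Finset.sum_eq_zero fun p _ => ?_
    rw [map_mul, mul_assoc]
    exact (congrArg _ (h p)).trans (mul_zero _)
  have right : ∀ z' : GraphCStarAlgebra E, (∀ p, z' * vertex p = 0) → ∀ c, z' * c = 0 := by
    intro z' h c
    refine (denseRange_ofLeavitt E).induction_on c
      (isClosed_eq (continuous_const_mul z') continuous_const) fun w => ?_
    obtain ⟨F, hF⟩ := exists_sum_vertex_mul ℂ w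
    rw [← hF, map_sum, Finset.mul_sum]
    refine Finset.sum_eq_zero fun p _ => ?_
    rw [map_mul, ← mul_assoc]
    exact (congrArg (· * _) (h p)).trans (zero_mul _)
  -- By density, `left` and `right` trade vertices for arbitrary factors but do not remove them.
  -- With z* as the factor on both sides, two applications of the C*-identity yield z = 0.
  have h1 : star z * z * star z = 0 := right _ (fun q => by
    rw [mul_assoc]
    exact left _ (fun p => by rw [← mul_assoc, hz]) _) _
  have h2 : star (star z * z) * (star z * z) = 0 := by
    rw [star_mul, star_star, ← mul_assoc, h1, zero_mul]
  exact (CStarRing.star_mul_self_eq_zero_iff z).1 ((CStarRing.star_mul_self_eq_zero_iff _).1 h2)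

section MatrixSystem

variable {E : DirectedGraph.{u, v}} {C : Type*} [NonUnitalCStarAlgebra C]
  {τ : ℕ → ℕ → GraphCStarAlgebra E →ₗ[ℂ] C}

/-- A system of matrix units over a graph C*-algebra gives an injective `*`-homomorphism on the
graph C*-algebra of the stabilization. -/
theorem exists_injective_hom_of_isMatrixSystem (h : IsMatrixSystem τ)
    (hstar : ∀ m n a, star (τ m n a) = τ n m (star a)) (hcont : ∀ m n, Continuous (τ m n))
    (h0 : Function.Injective (τ 0 0)) :
    ∃ φ : GraphCStarAlgebra E.stabilization →⋆ₙₐ[ℂ] C, Function.Injective φ ∧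
      ∀ m n a, τ m n a ∈ Set.range φ := by
  let τ' : ℕ → ℕ → LeavittPathAlgebra ℂ E →ₗ[ℂ] C := fun m n =>
    { toFun := fun a => τ m n (ofLeavitt E a)
      map_add' := fun a b => by rw [map_add, map_add]
      map_smul' := fun c a => by rw [map_smul, map_smul, RingHom.id_apply] }
  have h' : IsMatrixSystem τ' :=
    ⟨fun l m n a b => (h.mul_same l m n _ _).trans (congrArg (τ l n) (map_mul _ a b).symm),
      fun k l m n a b hlm => h.mul_of_ne k l m n _ _ hlm⟩
  have hstar' : ∀ m n a, star (τ' m n a) = τ' n m (star a) := fun m n a =>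
    (hstar m n _).trans (congrArg (τ n m) (map_star _ a).symm)
  obtain ⟨φ, hφc, hφ⟩ := exists_extension (E := E.stabilization) (C := C)
    { h'.stabHom with map_star' := h'.stabHom_star hstar' }
  replace hφ : ∀ x, φ (ofLeavitt E.stabilization x) = h'.stabHom x := hφ
  -- The extension of the level-0 inclusion to the C*-algebras. It is injective because φ ∘ ι = τ 0
  -- 0 is.
  obtain ⟨ι, hιc, hι⟩ := exists_extension (E := E) ((ofLeavitt E.stabilization).comp
    { baseHom ℂ E with map_star' := baseHom_star })
  replace hι : ∀ x, ι (ofLeavitt E x) = ofLeavitt E.stabilization (baseHom ℂ E x) := hι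
  have hφι : ∀ a, φ (ι a) = τ 0 0 a := fun a => by
    refine (denseRange_ofLeavitt E).induction_on a
      (isClosed_eq (hφc.comp hιc) (hcont 0 0)) fun x => ?_
    rw [hι, hφ, h'.stabHom_baseHom]
    rfl
  have hιinj : Function.Injective ι := fun a b hab => h0 (by rw [← hφι, ← hφι, hab])
  -- Closedness is what carries `headGhost_mul_mul_headPath_mem` from the dense Leavitt path algebra
  -- to all elements z below.
  have hιclosed : IsClosed (Set.range ι) :=
    (NonUnitalStarAlgHom.isometry ι hιinj).isClosedEmbedding.isClosed_range
  have hφinj : Function.Injective φ := by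
    refine (injective_iff_map_eq_zero φ).2 fun z hz => eq_zero_of_forall_vertex fun p q => ?_
    obtain ⟨x, m, rfl⟩ := exists_eq_stabVertex p
    obtain ⟨y, n, rfl⟩ := exists_eq_stabVertex q
    obtain ⟨a, ha⟩ : ofLeavitt E.stabilization (headGhost ℂ x m) * z *
        ofLeavitt E.stabilization (headPath ℂ y n) ∈ Set.range ι := by
      refine (denseRange_ofLeavitt E.stabilization).induction_on z
        (hιclosed.preimage ((continuous_mul_const _).comp (continuous_const_mul _))) fun w => ?_
      obtain ⟨a, ha⟩ := headGhost_mul_mul_headPath_mem x y m n w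
      exact ⟨ofLeavitt E a, by rw [hι, ha, map_mul, map_mul]⟩
    have h1 : τ 0 0 a = 0 := by rw [← hφι, ha, map_mul, map_mul, hz, mul_zero, zero_mul]
    rw [(injective_iff_map_eq_zero (τ 0 0)).1 h0 a h1, map_zero] at ha
    have h2 : ∀ x n, vertex (stabVertex x n) = ofLeavitt E.stabilization (headPath ℂ x n) *
        ofLeavitt E.stabilization (headGhost ℂ x n) := fun x n => by
      rw [← map_mul, headPath_mul_headGhost_self]
      rfl
    have h3 : vertex (stabVertex x m) * z * vertex (stabVertex y n) =
        ofLeavitt E.stabilization (headPath ℂ x m) * (ofLeavitt E.stabilization (headGhost ℂ x m) *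
          z * ofLeavitt E.stabilization (headPath ℂ y n)) *
          ofLeavitt E.stabilization (headGhost ℂ y n) := by
      rw [h2, h2]
      simp only [mul_assoc]
    rw [h3, ← ha, mul_zero, zero_mul]
  refine ⟨φ, hφinj, fun m n a => ?_⟩
  have hφclosed : IsClosed (Set.range φ) :=
    (NonUnitalStarAlgHom.isometry φ hφinj).isClosedEmbedding.isClosed_range
  refine (denseRange_ofLeavitt E).induction_on a (hφclosed.preimage (hcont m n)) fun x => ?_
  obtain ⟨z, hz⟩ := h'.mem_range_stabHom m n x
  exact ⟨ofLeavitt E.stabilization z, (hφ z).trans hz⟩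

end MatrixSystem

end GraphCStarAlgebra

/-! ### Matrix units in completed tensor products and the final isomorphisms. -/

section Tensor

open scoped TensorProduct
open Filter Topology

/-- The canonical map to the completion with respect to a C*-seminorm as a linear map. -/
noncomputable def CStarSeminorm.toCompletionₗ {B : Type*} [NonUnitalRing B] [Module ℂ B]
    [StarRing B] (p : CStarSeminorm B) : B →ₗ[ℂ] p.Completion :=
  (p.toCompletion : B →ₗ[ℂ] p.Completion)

namespace HilbertBasis

variable {A : Type*} [NonUnitalCStarAlgebra A] {H : Type*} [NormedAddCommGroup H]
  [InnerProductSpace ℂ H] [CompleteSpace H] (b : HilbertBasis ℕ ℂ H)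
  (γ : CStarSeminorm (A ⊗[ℂ] compactOperators H))

/-- The maps `a ↦ a ⊗ e_{mn}` to a completion of the algebraic tensor product with the compact
operators. -/
noncomputable def tensorMatrixSystem (m n : ℕ) : A →ₗ[ℂ] γ.Completion :=
  γ.toCompletionₗ ∘ₗ (TensorProduct.mk ℂ A (compactOperators H)).flip (b.matrixUnit m n)

theorem tensorMatrixSystem_apply (m n : ℕ) (a : A) :
    b.tensorMatrixSystem γ m n a = γ.toCompletion (a ⊗ₜ[ℂ] b.matrixUnit m n) := rfl

theorem tensorMatrixSystem_mul (k l m n : ℕ) (a a' : A) :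
    b.tensorMatrixSystem γ k l a * b.tensorMatrixSystem γ m n a' =
      γ.toCompletion ((a * a') ⊗ₜ[ℂ] (b.matrixUnit k l * b.matrixUnit m n)) :=
  (γ.toCompletion.map_mul' _ _).symm.trans
    (congrArg γ.toCompletion (Algebra.TensorProduct.tmul_mul_tmul a a' _ _))

theorem isMatrixSystem_tensorMatrixSystem :
    LeavittPathAlgebra.IsMatrixSystem (b.tensorMatrixSystem γ) where
  mul_same l m n a a' := by
    rw [tensorMatrixSystem_mul, matrixUnit_mul_same, tensorMatrixSystem_apply]
  mul_of_ne k l m n a a' hlm := by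
    rw [tensorMatrixSystem_mul, matrixUnit_mul_of_ne _ _ _ _ _ hlm, TensorProduct.tmul_zero]
    exact map_zero γ.toCompletionₗ

theorem star_tensorMatrixSystem (m n : ℕ) (a : A) :
    star (b.tensorMatrixSystem γ m n a) = b.tensorMatrixSystem γ n m (star a) := by
  rw [tensorMatrixSystem_apply, tensorMatrixSystem_apply, ← map_star, TensorProduct.star_tmul,
    star_matrixUnit]

variable {γ}

theorem norm_toCompletion_tmul_le (hγ : γ ∈ tensorSeminorms A (compactOperators H)) (a : A)
    (T : compactOperators H) : ‖γ.toCompletion (a ⊗ₜ[ℂ] T)‖ ≤ ‖a‖ * ‖T‖ :=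
  (γ.norm_toCompletion _).le.trans (hγ a T)

theorem continuous_tensorMatrixSystem (hγ : γ ∈ tensorSeminorms A (compactOperators H))
    (m n : ℕ) : Continuous (b.tensorMatrixSystem γ m n) :=
  AddMonoidHomClass.continuous_of_bound _ ‖b.matrixUnit m n‖ fun a => by
    rw [mul_comm]
    exact norm_toCompletion_tmul_le hγ a _

/-- For fixed a the map T ↦ a ⊗ T is continuous by the cross-norm bound, and T is a limit of
combinations of matrix units. So S contains the elementary tensors, hence a dense subspace. -/
theorem mem_of_forall_tensorMatrixSystem_mem (hγ : γ ∈ tensorSeminorms A (compactOperators H))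
    (S : Submodule ℂ γ.Completion) (hS : IsClosed (S : Set γ.Completion))
    (h : ∀ m n a, b.tensorMatrixSystem γ m n a ∈ S) (y : γ.Completion) : y ∈ S := by
  have htmul : ∀ a T, γ.toCompletion (a ⊗ₜ[ℂ] T) ∈ S := by
    intro a T
    let f : compactOperators H →ₗ[ℂ] γ.Completion :=
      γ.toCompletionₗ ∘ₗ TensorProduct.mk ℂ A (compactOperators H) a
    have hf : Continuous f :=
      AddMonoidHomClass.continuous_of_bound f ‖a‖ fun T => norm_toCompletion_tmul_le hγ a T
    refine hS.mem_of_tendsto ((hf.tendsto T).comp (b.tendsto_sum_matrixUnit T))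
      (Eventually.of_forall fun N => ?_)
    simp only [Function.comp_apply, map_sum, map_smul]
    exact S.sum_mem fun m _ => S.sum_mem fun n _ => S.smul_mem _ (h m n a)
  refine γ.denseRange_toCompletion.induction_on y hS fun x => ?_
  change γ.toCompletionₗ x ∈ S
  induction x with
  | zero => exact (map_zero γ.toCompletionₗ).symm ▸ S.zero_mem
  | tmul a T => exact htmul a T
  | add x y hx hy => exact (map_add γ.toCompletionₗ x y).symm ▸ S.add_mem hx hy

end HilbertBasis

/-- The graph C*-algebra of the stabilization is isomorphic to the completion of the algebraic
tensor product with the compact operators in a C*-seminorm that is faithful on a corner. -/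
theorem GraphCStarAlgebra.nonempty_starAlgEquiv_completion (E : DirectedGraph.{u, v}) {H : Type*}
    [NormedAddCommGroup H] [InnerProductSpace ℂ H] [CompleteSpace H] (b : HilbertBasis ℕ ℂ H)
    {γ : CStarSeminorm (GraphCStarAlgebra E ⊗[ℂ] compactOperators H)}
    (hγ : γ ∈ tensorSeminorms (GraphCStarAlgebra E) (compactOperators H))
    (h0 : ∀ a, γ (a ⊗ₜ[ℂ] b.matrixUnit 0 0) = 0 → a = 0) :
    Nonempty (GraphCStarAlgebra E.stabilization ≃⋆ₐ[ℂ] γ.Completion) := by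
  have hinj : Function.Injective (b.tensorMatrixSystem γ 0 0) :=
    (injective_iff_map_eq_zero _).2 fun a ha => h0 a (by
      rw [← γ.norm_toCompletion, ← b.tensorMatrixSystem_apply, ha, norm_zero])
  obtain ⟨φ, hφ, hrange⟩ := exists_injective_hom_of_isMatrixSystem
    (b.isMatrixSystem_tensorMatrixSystem γ) (b.star_tensorMatrixSystem γ)
    (b.continuous_tensorMatrixSystem hγ) hinj
  -- As φ is isometric, its range is a closed subspace; it contains all a ⊗ e_{mn} and is therefore
  -- everything.
  have hclosed : IsClosed (Set.range φ) :=
    (NonUnitalStarAlgHom.isometry φ hφ).isClosedEmbedding.isClosed_range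
  exact ⟨StarAlgEquiv.ofBijective φ ⟨hφ, b.mem_of_forall_tensorMatrixSystem_mem hγ
    (LinearMap.range (φ : GraphCStarAlgebra E.stabilization →ₗ[ℂ] γ.Completion)) hclosed hrange⟩⟩

theorem maxTensorSeminorm_mem (A B : Type*) [NonUnitalCStarAlgebra A] [NonUnitalCStarAlgebra B] :
    maxTensorSeminorm A B ∈ tensorSeminorms A B := fun a b =>
  Real.iSup_le (fun γ => γ.2 a b) (by positivity)

theorem le_maxTensorSeminorm {A B : Type*} [NonUnitalCStarAlgebra A] [NonUnitalCStarAlgebra B]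
    {γ : CStarSeminorm (A ⊗[ℂ] B)} (hγ : γ ∈ tensorSeminorms A B) (x : A ⊗[ℂ] B) :
    γ x ≤ maxTensorSeminorm A B x :=
  le_ciSup (bddAbove_tensorSeminorms A B x) ⟨γ, hγ⟩

end Tensor

open scoped TensorProduct in
theorem mainTheorem10 (E : DirectedGraph.{u, v}) :
    Nonempty (LeavittPathAlgebra ℂ E.stabilization ≃⋆ₐ[ℂ] MInfty (LeavittPathAlgebra ℂ E)) ∧
    (∀ (K : Type*) [Field K],
      ∃ φ : LeavittPathAlgebra K E.stabilization →ₙₐ[K] MInfty (LeavittPathAlgebra K E),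
        Function.Bijective φ) ∧
    (∀ (H : Type*) [NormedAddCommGroup H] [InnerProductSpace ℂ H] [CompleteSpace H]
        [TopologicalSpace.SeparableSpace H], ¬ FiniteDimensional ℂ H →
      Nonempty (GraphCStarAlgebra E.stabilization ≃⋆ₐ[ℂ]
        MaxTensor (GraphCStarAlgebra E) (compactOperators H)) ∧
      ∀ γ : CStarSeminorm (GraphCStarAlgebra E ⊗[ℂ] compactOperators H),
        γ ∈ tensorSeminorms (GraphCStarAlgebra E) (compactOperators H) → γ.IsNorm →
        Nonempty (GraphCStarAlgebra E.stabilization ≃⋆ₐ[ℂ] γ.Completion)) := by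
  refine ⟨LeavittPathAlgebra.nonempty_starAlgEquiv_minfty ℂ E, fun K _ =>
    LeavittPathAlgebra.exists_bijective_hom_minfty K E, fun H _ _ _ _ hH => ?_⟩
  obtain ⟨b⟩ := nonempty_hilbertBasis_nat H hH
  obtain ⟨γ₀, hγ₀, hle⟩ := b.exists_mem_tensorSeminorms (A := GraphCStarAlgebra E)
  -- The maximal seminorm dominates γ₀, which is at least ‖a‖ on a ⊗ e_{00}.
  have hmax : ∀ a, maxTensorSeminorm (GraphCStarAlgebra E) (compactOperators H)
      (a ⊗ₜ[ℂ] b.matrixUnit 0 0) = 0 → a = 0 := fun a ha =>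
    norm_le_zero_iff.1 (((hle a).trans (le_maxTensorSeminorm hγ₀ _)).trans_eq ha)
  refine ⟨GraphCStarAlgebra.nonempty_starAlgEquiv_completion E b (maxTensorSeminorm_mem _ _) hmax,
    fun γ hγ hnorm => GraphCStarAlgebra.nonempty_starAlgEquiv_completion E b hγ fun a ha =>
      hmax a ?_⟩
  -- A C*-norm vanishes on a ⊗ e_{00} only if this tensor is 0; then the maximal seminorm vanishes
  -- on it too, and `hmax` gives a = 0.
  rw [hnorm _ ha]
  exact map_zero (maxTensorSeminorm _ _).toSeminorm
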